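/- Throughout, graphs are finite, simple and undirected. A cluster graph is a disjoint union of complete graphs. A hitting set of a graph $G$ is a set $X \subseteq V(G)$ such that $G - X$ is a cluster graph (equivalently, $X$ meets every vertex set that induces a path on three vertices). For a cost function $c : V(G) \to \mathbb{R}_{\geqslant 0}$, let $\mathrm{OPT}(G,c)$ be the minimum of $c(X) = \sum_{v \in X} c(v)$ over all hitting sets $X$ of $G$. Let $$P(G) := \{ x \in [0,1]^{V(G)} \mid x_u + x_v + x_w \geqslant 1 \text{ for all } \{u,v,w\} \subseteq V(G) \text{ inducing a path on three vertices}\},$$ described by the inequalities $x_v \geqslant 0$, $x_v \leqslant 1$ and $x_u+x_v+x_w \geqslant 1$. For an integer $r \geqslant 0$, let $\mathrm{SA}_r(G) \subseteq \mathbb{R}^{V(G)}$ be the relaxation obtained from $P(G)$ by $r$ rounds of the Sherali–Adams hierarchy: multiply each of these inequalities by $\prod_{i \in I} x_i \prod_{j \in J} (1-x_j)$, for all disjoint $I, J \subseteq V(G)$ with $|I|+|J| \leqslant r$; linearize the result by setting $x_i^2 := x_i$ and replacing each product $\prod_{i \in I} x_i$ with $|I| \geqslant 2$ by a new variable $x_I$;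 and project the solution set of the resulting linear system onto the variables $x_v$, $v \in V(G)$. Let $\mathrm{SA}_r(G,c) := \min\{\sum_{v} c(v) x_v \mid x \in \mathrm{SA}_r(G)\}$. **Theorem.** There is a polynomial $p$ with real coefficients such that for every real $\varepsilon > 0$ there is an integer $r \geqslant 0$ with $r \leqslant p(1/\varepsilon)$ for which $\mathrm{SA}_r$ is an LP relaxation of the cluster vertex deletion problem with integrality gap at most $2+\varepsilon$. That is, for every graph $G$, the characteristic vector of every hitting set of $G$ belongs to $\mathrm{SA}_r(G)$, and $$\mathrm{OPT}(G,c) \leqslant (2+\varepsilon)\cdot \mathrm{SA}_r(G,c) \quad \text{for every cost function } c : V(G) \to \mathbb{R}_{\geqslant 0}.$$ -/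

import Mathlib

open scoped BigOperators

noncomputable section

/-! ## Cluster vertex deletion -/

/-- A cluster graph is a disjoint union of complete graphs: any two distinct vertices in the
same connected component are adjacent. -/
def IsClusterGraph {V : Type*} (G : SimpleGraph V) : Prop :=
  ∀ u v : V, G.Reachable u v → u ≠ v → G.Adj u v

/-- `X` is a hitting set of `G` if `G - X` is a cluster graph. -/
def IsHittingSet {V : Type*} (G : SimpleGraph V) (X : Finset V) : Prop :=
  IsClusterGraph (G.induce ((X : Set V)ᶜ))

/-- The cost `c(X) = ∑ v ∈ X, c v` of a set of vertices. -/
def setCost {V : Type*} (c : V → ℝ) (X : Finset V) : ℝ :=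
  ∑ v ∈ X, c v

/-- `OPT(G, c)`: the minimum cost of a hitting set of `G`. There are finitely many candidates,
and the whole vertex set is one of them, so the infimum is a minimum. -/
def clusterOPT {V : Type*} [Fintype V] (G : SimpleGraph V) (c : V → ℝ) : ℝ :=
  sInf {t : ℝ | ∃ X : Finset V, IsHittingSet G X ∧ t = setCost c X}

/-! ## The Sherali-Adams hierarchy -/

/-- A system of linear inequalities on `ℝ^V`. The pair `(a, b)` stands for `∑ v, a v * x v ≥ b`. -/
abbrev LinearSystem (V : Type*) := Set ((V → ℝ) × ℝ)

/-- The polyhedron `{x | A x ≥ b}` of solutions of a system. -/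
def LinearSystem.solutions {V : Type*} [Fintype V] (S : LinearSystem V) : Set (V → ℝ) :=
  {x | ∀ q ∈ S, q.2 ≤ ∑ v, q.1 v * x v}

/-- The polynomial `(∑ v, a v * X v - b) * ∏ i ∈ I, X i * ∏ j ∈ J, (1 - X j)`: the constraint
`(a, b)`, written as `∑ v, a v * x v - b ≥ 0`, after multiplication by the product. -/
def multipliedConstraint {V : Type*} [Fintype V] (q : (V → ℝ) × ℝ) (I J : Finset V) :
    MvPolynomial V ℝ :=
  (∑ v, MvPolynomial.C (q.1 v) * MvPolynomial.X v - MvPolynomial.C q.2) *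
    (∏ i ∈ I, MvPolynomial.X i) * ∏ j ∈ J, (1 - MvPolynomial.X j)

/-- The linearization: substitute `x_i ^ 2 := x_i`, and then the variable `y I` for the product
`∏ i ∈ I, x_i`. It is the linear map that sends a monomial to `y` of the set of the variables
that occur in it. -/
def linearize {V : Type*} (y : Finset V → ℝ) : MvPolynomial V ℝ →ₗ[ℝ] ℝ :=
  (MvPolynomial.basisMonomials V ℝ).constr ℝ fun m => y m.support

/-- `y` solves the linear system `L_r`: the empty product is `1`, and every constraint of `S`,
multiplied by `∏ i ∈ I, x_i * ∏ j ∈ J, (1 - x_j)` with `I`, `J` disjoint and `|I| + |J| ≤ r` and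
then linearized, holds. The case `I = J = ∅` keeps the constraints of `S` themselves, so zero
rounds give back `S`. -/
def IsSheraliAdamsSolution {V : Type*} [Fintype V] (S : LinearSystem V) (r : ℕ)
    (y : Finset V → ℝ) : Prop :=
  y ∅ = 1 ∧ ∀ q ∈ S, ∀ I J : Finset V, Disjoint I J → I.card + J.card ≤ r →
    0 ≤ linearize y (multipliedConstraint q I J)

/-- The relaxation after `r` rounds of Sherali-Adams: the projection of the solutions of `L_r` to
the variables `x_v = y {v}`. -/
def sheraliAdams {V : Type*} [Fintype V] (S : LinearSystem V) (r : ℕ) : Set (V → ℝ) :=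
  {x | ∃ y : Finset V → ℝ, IsSheraliAdamsSolution S r y ∧ ∀ v, x v = y {v}}

/-! ## The LP relaxation of cluster vertex deletion -/

/-- The collection of all vertex sets `{u, v, w}` that induce a path on three vertices
(here with middle vertex `v`). -/
def inducedP3s {V : Type*} (G : SimpleGraph V) : Set (Set V) :=
  {s | ∃ u v w : V, s = {u, v, w} ∧ G.Adj u v ∧ G.Adj v w ∧ u ≠ w ∧ ¬ G.Adj u w}

open Classical in
/-- The system that defines `P(G)`: `x_v ≥ 0` and `-x_v ≥ -1` for all vertices `v`, and
`x_u + x_v + x_w ≥ 1` for all induced paths `{u, v, w}` on three vertices. -/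
def p3System {V : Type*} (G : SimpleGraph V) : LinearSystem V :=
  {q | (∃ v, q = (Pi.single v 1, 0)) ∨ (∃ v, q = (-Pi.single v 1, -1)) ∨
    ∃ s ∈ inducedP3s G, q = (s.indicator 1, 1)}

/-- `SA_r(G)`. -/
def clusterSA {V : Type*} [Fintype V] (r : ℕ) (G : SimpleGraph V) : Set (V → ℝ) :=
  sheraliAdams (p3System G) r

/-- `SA_r(G, c)`: the optimum value of minimizing `∑ v, c v * x v` over `SA_r(G)`. -/
def clusterSAValue {V : Type*} [Fintype V] (r : ℕ) (G : SimpleGraph V) (c : V → ℝ) : ℝ :=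
  sInf {t : ℝ | ∃ x ∈ clusterSA r G, t = ∑ v, c v * x v}

end

/-!
The multiplier `∏ i ∈ I, x_i * ∏ j ∈ H \ I, (1 - x_j)` of a set `H` with at most `r` elements is
the indicator of the outcome `I` on `H`. So on `H` a point `x` of `SA_r(G)` is a convex combination
of restrictions of hitting sets, and it satisfies every inequality that these satisfy.

Round `x` by local ratio with ratio `α = 2 + ε`. Vertices with `α * x v ≥ 1` are deleted, and the
cost of a vertex that has a true twin is moved to the twin. If neither reduction applies, then every
weight of total at most `r` has more than a fraction `1 - 1 / α` of its mass on an induced cluster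
graph. Inside the neighborhood of a vertex `o` this forbids induced four- and five-cycles and pairs
of induced paths on three vertices with few edges between them, and it bounds cliques and
independent sets by about `1 / ε`. Hence the neighborhood has `O(1 / ε ^ 3)` vertices, and after
identifying its twins it contains a clique that meets all of its induced paths on three vertices.

Such a clique yields positive integer weights on the closed neighborhood for which every induced
cluster graph has at most half of the total weight, rounded up. Vertices outside the neighborhood
separate the members of a twin class, and weights on them let the class act as a single vertex.
For the resulting weights `d` local feasibility of `x` gives `d(V) ≤ 2 * ∑ v, d v * x v + 1`.
The part of `G` that is kept can always be chosen to meet the closed neighborhood of `o`, so it has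
`d`-weight at least one, and this pays for the error term in the local ratio step.
-/

section SheraliAdams

open Finset MvPolynomial

variable {V : Type*} {S : LinearSystem V} {r : ℕ} {x : V → ℝ} {y : Finset V → ℝ}
  {H I J : Finset V} {v : V}

theorem linearize_monomial (y : Finset V → ℝ) (m : V →₀ ℕ) (a : ℝ) :
    linearize y (monomial m a) = a * y m.support := by
  have h : (monomial m a : MvPolynomial V ℝ) = a • basisMonomials V ℝ m := by
    simp [smul_monomial]
  rw [h, map_smul, linearize, Module.Basis.constr_basis, smul_eq_mul]

theorem linearize_one (y : Finset V → ℝ) : linearize y 1 = y ∅ := by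
  simpa using linearize_monomial y 0 1

theorem linearize_X (y : Finset V → ℝ) (v : V) : linearize y (X v) = y {v} := by
  rw [X, linearize_monomial, one_mul, Finsupp.support_single v one_ne_zero]

theorem linearize_X_mul_X_mul (y : Finset V → ℝ) (v : V) (p : MvPolynomial V ℝ) :
    linearize y (X v * (X v * p)) = linearize y (X v * p) := by
  induction p using MvPolynomial.induction_on' with
  | monomial m a =>
    simp only [X, monomial_mul, linearize_monomial, one_mul]
    congr 2
    ext z
    simp only [Finsupp.mem_support_iff, Finsupp.add_apply]
    omega
  | add p q hp hq => simp only [mul_add, map_add, hp, hq]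

theorem linearize_X_mul_one_sub_X_mul (y : Finset V → ℝ) (v : V) (p : MvPolynomial V ℝ) :
    linearize y (X v * ((1 - X v) * p)) = 0 := by
  rw [sub_mul, one_mul, mul_sub, map_sub, linearize_X_mul_X_mul, sub_self]

/-- The multiplier `∏ i ∈ I, x_i * ∏ j ∈ J, (1 - x_j)`. For `J = H \ I` it is the indicator of
the event that a random subset of `H` equals `I`. -/
noncomputable def literalProduct (I J : Finset V) : MvPolynomial V ℝ :=
  (∏ i ∈ I, X i) * ∏ j ∈ J, (1 - X j)

theorem sum_linearize_mul_literalProduct [DecidableEq V] (y : Finset V → ℝ)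
    (p : MvPolynomial V ℝ) (H : Finset V) :
    ∑ I ∈ H.powerset, linearize y (p * literalProduct I (H \ I)) = linearize y p := by
  have hsum : ∑ I ∈ H.powerset, literalProduct I (H \ I) = 1 := by
    have hprod := prod_add (fun i : V => (X i : MvPolynomial V ℝ)) (fun i => 1 - X i) H
    simp only [add_sub_cancel, prod_const_one] at hprod
    exact hprod.symm
  rw [← map_sum, ← mul_sum, hsum, mul_one]

theorem linearize_X_mul_literalProduct_of_mem_left (y : Finset V → ℝ) (hv : v ∈ I) :
    linearize y (X v * literalProduct I J) = linearize y (literalProduct I J) := by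
  classical
  have hfactor : literalProduct I J = X v * literalProduct (I.erase v) J := by
    rw [literalProduct, literalProduct, ← mul_prod_erase I _ hv, mul_assoc]
  rw [hfactor, linearize_X_mul_X_mul]

theorem linearize_X_mul_literalProduct_of_mem_right (y : Finset V → ℝ) (hv : v ∈ J) :
    linearize y (X v * literalProduct I J) = 0 := by
  classical
  have hfactor : literalProduct I J = (1 - X v) * literalProduct I (J.erase v) := by
    rw [literalProduct, literalProduct, ← mul_prod_erase J _ hv, mul_left_comm]
  rw [hfactor, linearize_X_mul_one_sub_X_mul]

theorem sum_linearize_literalProduct_of_mem [DecidableEq V] (y : Finset V → ℝ) (hv : v ∈ H) :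
    ∑ I ∈ H.powerset with v ∈ I, linearize y (literalProduct I (H \ I)) = y {v} := by
  rw [← linearize_X y v, ← sum_linearize_mul_literalProduct y _ H, sum_filter]
  refine sum_congr rfl fun I _ => ?_
  split_ifs with hvI
  · exact (linearize_X_mul_literalProduct_of_mem_left y hvI).symm
  · exact (linearize_X_mul_literalProduct_of_mem_right y (mem_sdiff.2 ⟨hv, hvI⟩)).symm

theorem linearize_subset_eq_eval_indicator [DecidableEq V] (Y : Finset V)
    (p : MvPolynomial V ℝ) :
    linearize (fun I => if I ⊆ Y then 1 else 0) p = eval ((Y : Set V).indicator 1) p := by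
  induction p using MvPolynomial.induction_on' with
  | monomial m a =>
    rw [linearize_monomial, eval_monomial, Finsupp.prod]
    congr 1
    split_ifs with hm
    · exact (prod_eq_one fun v hv => by simp [hm hv]).symm
    · obtain ⟨v, hv, hvY⟩ := not_subset.1 hm
      exact (prod_eq_zero hv (by simp [hvY, Finsupp.mem_support_iff.1 hv])).symm
  | add p q hp hq => rw [map_add, map_add, hp, hq]

variable [Fintype V]

theorem linearize_multipliedConstraint (y : Finset V → ℝ) (q : (V → ℝ) × ℝ) (I J : Finset V) :
    linearize y (multipliedConstraint q I J) =
      ∑ v, q.1 v * linearize y (X v * literalProduct I J) -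
        q.2 * linearize y (literalProduct I J) := by
  have hexpand : multipliedConstraint q I J =
      ∑ v, q.1 v • (X v * literalProduct I J) - q.2 • literalProduct I J := by
    rw [multipliedConstraint, mul_assoc, ← literalProduct, sub_mul, sum_mul]
    simp only [smul_eq_C_mul, mul_assoc]
  rw [hexpand, map_sub, map_sum]
  simp only [map_smul, smul_eq_mul]

theorem indicator_mem_sheraliAdams {Y : Finset V} (hY : (Y : Set V).indicator 1 ∈ S.solutions)
    (r : ℕ) : (Y : Set V).indicator 1 ∈ sheraliAdams S r := by
  classical
  refine ⟨fun I => if I ⊆ Y then 1 else 0, ⟨by simp, fun q hq I J _ _ => ?_⟩,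
    fun v => by simp [Set.indicator_apply]⟩
  rw [linearize_subset_eq_eval_indicator, multipliedConstraint, map_mul, map_mul, map_prod,
    map_prod]
  refine mul_nonneg (mul_nonneg ?_ (prod_nonneg fun v _ => ?_)) (prod_nonneg fun v _ => ?_)
  · simpa using hY q hq
  · simp [Set.indicator_apply, apply_ite]
  · by_cases hv : v ∈ Y <;> simp [hv]

theorem IsSheraliAdamsSolution.linearize_literalProduct_nonneg [DecidableEq V]
    (hbox : ∀ v, (Pi.single v 1, 0) ∈ S ∧ (-Pi.single v 1, -1) ∈ S)
    (hy : IsSheraliAdamsSolution S r y) (hIJ : Disjoint I J) (hr : #I + #J ≤ r) :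
    0 ≤ linearize y (literalProduct I J) := by
  rcases isEmpty_or_nonempty V with hV | ⟨⟨v⟩⟩
  · simp [literalProduct, Finset.eq_empty_of_isEmpty, linearize_one, hy.1]
  · have hlower := hy.2 _ (hbox v).1 I J hIJ hr
    have hupper := hy.2 _ (hbox v).2 I J hIJ hr
    simp only [linearize_multipliedConstraint, Pi.neg_apply, Pi.single_apply, ite_mul, neg_mul,
      one_mul, zero_mul, sum_neg_distrib, sum_ite_eq', mem_univ, if_true] at hlower hupper
    linarith

theorem IsSheraliAdamsSolution.linearize_literalProduct_nonpos [DecidableEq V]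
    (hy : IsSheraliAdamsSolution S r y) (hr : #H ≤ r) (hIH : I ⊆ H) {q : (V → ℝ) × ℝ}
    (hq : q ∈ S) (hqH : ∀ v ∉ H, q.1 v = 0) (hqI : ∑ v ∈ I, q.1 v < q.2) :
    linearize y (literalProduct I (H \ I)) ≤ 0 := by
  have hcard : #I + #(H \ I) ≤ r := by
    rwa [add_comm, card_sdiff_add_card_eq_card hIH]
  have hterm : ∀ v, q.1 v * linearize y (X v * literalProduct I (H \ I)) =
      if v ∈ I then q.1 v * linearize y (literalProduct I (H \ I)) else 0 := by
    intro v
    split_ifs with hvI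
    · rw [linearize_X_mul_literalProduct_of_mem_left y hvI]
    · by_cases hvH : v ∈ H
      · rw [linearize_X_mul_literalProduct_of_mem_right y (mem_sdiff.2 ⟨hvH, hvI⟩), mul_zero]
      · rw [hqH v hvH, zero_mul]
  have hq' := hy.2 q hq I (H \ I) disjoint_sdiff hcard
  rw [linearize_multipliedConstraint, sum_congr rfl fun v _ => hterm v, sum_ite_mem, univ_inter,
    ← sum_mul, ← sub_mul] at hq'
  exact nonpos_of_mul_nonneg_right hq' (sub_neg.2 hqI)

theorem le_sum_mul_of_mem_sheraliAdams [DecidableEq V]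
    (hbox : ∀ v, (Pi.single v 1, 0) ∈ S ∧ (-Pi.single v 1, -1) ∈ S)
    (hx : x ∈ sheraliAdams S r) (hr : #H ≤ r) {c : V → ℝ} {L : ℝ}
    (hL : ∀ I ⊆ H, (∀ q ∈ S, (∀ v ∉ H, q.1 v = 0) → q.2 ≤ ∑ v ∈ I, q.1 v) → L ≤ ∑ v ∈ I, c v) :
    L ≤ ∑ v ∈ H, c v * x v := by
  obtain ⟨y, hy, hxy⟩ := hx
  set μ : Finset V → ℝ := fun I => linearize y (literalProduct I (H \ I))
  have hμ : ∑ I ∈ H.powerset, μ I = 1 := by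
    simpa only [one_mul, linearize_one, hy.1] using sum_linearize_mul_literalProduct y 1 H
  have hexpect : ∑ v ∈ H, c v * x v = ∑ I ∈ H.powerset, μ I * ∑ v ∈ I, c v := by
    calc ∑ v ∈ H, c v * x v = ∑ v ∈ H, ∑ I ∈ H.powerset with v ∈ I, μ I * c v :=
          sum_congr rfl fun v hv => by
            rw [hxy, ← sum_linearize_literalProduct_of_mem y hv, mul_comm, sum_mul]
      _ = ∑ I ∈ H.powerset, ∑ v ∈ I, μ I * c v :=
          sum_comm' fun v I => by
            simp only [mem_filter, mem_powerset]
            exact ⟨fun h => ⟨h.2.2, h.2.1⟩, fun h => ⟨h.2 h.1, h.2, h.1⟩⟩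
      _ = ∑ I ∈ H.powerset, μ I * ∑ v ∈ I, c v := by simp only [mul_sum]
  rw [hexpect, ← one_mul L, ← hμ, sum_mul]
  refine sum_le_sum fun I hI => ?_
  have hIH : I ⊆ H := mem_powerset.1 hI
  have hnonneg : 0 ≤ μ I := hy.linearize_literalProduct_nonneg hbox disjoint_sdiff
    (by rwa [add_comm, card_sdiff_add_card_eq_card hIH])
  by_cases hI' : ∀ q ∈ S, (∀ v ∉ H, q.1 v = 0) → q.2 ≤ ∑ v ∈ I, q.1 v
  · exact mul_le_mul_of_nonneg_left (hL I hIH hI') hnonneg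
  · push Not at hI'
    obtain ⟨q, hq, hqH, hqI⟩ := hI'
    have hzero : μ I = 0 :=
      (hy.linearize_literalProduct_nonpos hr hIH hq hqH hqI).antisymm hnonneg
    rw [hzero, zero_mul, zero_mul]

end SheraliAdams

section Feasibility

open Finset

variable {V : Type*} {G : SimpleGraph V} {r : ℕ} {x : V → ℝ} {S T X : Finset V}

/-- No three vertices of `S` induce a path; equivalently, `S` induces a cluster graph. -/
def P3Free (G : SimpleGraph V) (S : Finset V) : Prop :=
  ∀ u ∈ S, ∀ v ∈ S, ∀ w ∈ S, G.Adj u v → G.Adj v w → u ≠ w → G.Adj u w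

theorem P3Free.mono (hT : P3Free G T) (hST : S ⊆ T) : P3Free G S :=
  fun u hu v hv w hw => hT u (hST hu) v (hST hv) w (hST hw)

theorem isClusterGraph_iff :
    IsClusterGraph G ↔ ∀ u v w, G.Adj u v → G.Adj v w → u ≠ w → G.Adj u w := by
  constructor
  · intro hG u v w huv hvw
    exact hG u w (huv.reachable.trans hvw.reachable)
  · rintro hG u v ⟨p⟩
    induction p with
    | nil => exact fun hne => absurd rfl hne
    | @cons a b c hab p ih =>
      intro hac
      obtain rfl | hbc := eq_or_ne b c
      · exact hab
      · exact hG a b c hab (ih hbc) hac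

theorem isHittingSet_iff [Fintype V] [DecidableEq V] :
    IsHittingSet G X ↔ P3Free G (univ \ X) := by
  simp [IsHittingSet, isClusterGraph_iff, P3Free, Subtype.ext_iff]

theorem sum_indicator_triple_mul [Fintype V] {u v w : V} (huv : u ≠ v) (huw : u ≠ w)
    (hvw : v ≠ w) (f : V → ℝ) :
    ∑ z, (({u, v, w} : Set V).indicator 1 z : ℝ) * f z = f u + f v + f w := by
  classical
  have hterm : ∀ z, (({u, v, w} : Set V).indicator 1 z : ℝ) * f z =
      if z ∈ ({u, v, w} : Finset V) then f z else 0 := by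
    simp [Set.indicator_apply]
  rw [sum_congr rfl fun z _ => hterm z, sum_ite_mem, univ_inter,
    sum_insert (by simp [huv, huw]), sum_pair hvw, add_assoc]

theorem indicator_mem_solutions_p3System [Fintype V] (hX : IsHittingSet G X) :
    (X : Set V).indicator 1 ∈ (p3System G).solutions := by
  classical
  rintro q (⟨v, rfl⟩ | ⟨v, rfl⟩ | ⟨s, ⟨u, v, w, rfl, huv, hvw, huw, hn⟩, rfl⟩)
  · by_cases hv : v ∈ X <;> simp [Pi.single_apply, hv]
  · by_cases hv : v ∈ X <;> simp [Pi.single_apply, hv]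
  · have hmeet : u ∈ X ∨ v ∈ X ∨ w ∈ X := by
      by_contra! hmiss
      exact hn (isHittingSet_iff.1 hX u (by simp [hmiss]) v (by simp [hmiss]) w (by simp [hmiss])
        huv hvw huw)
    rw [sum_indicator_triple_mul huv.ne huw hvw.ne]
    by_cases hu : u ∈ X <;> by_cases hv : v ∈ X <;> by_cases hw : w ∈ X <;>
      simp [hu, hv, hw] at hmeet ⊢

theorem indicator_mem_clusterSA [Fintype V] (r : ℕ) (hX : IsHittingSet G X) :
    (X : Set V).indicator 1 ∈ clusterSA r G :=
  indicator_mem_sheraliAdams (indicator_mem_solutions_p3System hX) r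

theorem clusterSA_nonempty [Fintype V] (G : SimpleGraph V) (r : ℕ) : (clusterSA r G).Nonempty := by
  classical
  exact ⟨_, indicator_mem_clusterSA r (X := univ) (isHittingSet_iff.2 (by simp [P3Free]))⟩

/-- On each vertex set of size at most `r` the point `x` satisfies all inequalities that hold for
the characteristic vectors of hitting sets, expressed through the complements of hitting sets. -/
def LocallyFeasible (G : SimpleGraph V) (r : ℕ) (x : V → ℝ) : Prop :=
  ∀ H : Finset V, #H ≤ r → ∀ (c : V → ℝ) (L : ℝ),
    (∀ S ⊆ H, P3Free G S → ∑ v ∈ S, c v ≤ L) → ∑ v ∈ H, c v * (1 - x v) ≤ L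

theorem LocallyFeasible.sum_mul_one_sub_le {H U : Finset V} {c : V → ℝ} {L : ℝ}
    (hx : LocallyFeasible G r x) (hHU : H ⊆ U) (hr : #H ≤ r) (hc : ∀ v ∈ U, v ∉ H → c v = 0)
    (hL : ∀ S ⊆ U, P3Free G S → ∑ v ∈ S, c v ≤ L) : ∑ v ∈ U, c v * (1 - x v) ≤ L := by
  rw [← sum_subset hHU fun v hv hvH => by rw [hc v hv hvH, zero_mul]]
  exact hx H hr c L fun S hS => hL S (hS.trans hHU)

theorem locallyFeasible_of_mem_clusterSA [Fintype V] (hx : x ∈ clusterSA r G) :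
    LocallyFeasible G r x := by
  classical
  intro H hr c L hL
  have hbound : ∑ v ∈ H, c v - L ≤ ∑ v ∈ H, c v * x v := by
    refine le_sum_mul_of_mem_sheraliAdams
      (fun v => ⟨.inl ⟨v, rfl⟩, .inr (.inl ⟨v, rfl⟩)⟩) hx hr fun I hIH hI => ?_
    have hfree : P3Free G (H \ I) := by
      intro u hu v hv w hw huv hvw huw
      by_contra hn
      obtain ⟨⟨huH, huI⟩, ⟨hvH, hvI⟩, ⟨hwH, hwI⟩⟩ :=
        And.intro (mem_sdiff.1 hu) (And.intro (mem_sdiff.1 hv) (mem_sdiff.1 hw))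
      have hviolated := hI (({u, v, w} : Set V).indicator 1, 1)
        (.inr (.inr ⟨_, ⟨u, v, w, rfl, huv, hvw, huw, hn⟩, rfl⟩))
        (fun z hz => Set.indicator_of_notMem (by aesop) _)
      rw [sum_eq_zero fun z hz => Set.indicator_of_notMem (by aesop) _] at hviolated
      exact absurd hviolated (by norm_num)
    linarith [hL _ sdiff_subset hfree, sum_sdiff hIH (f := c)]
  simp only [mul_sub, mul_one, sum_sub_distrib]
  linarith

end Feasibility

section HeavyClusters

open Finset

variable {V : Type*} {G : SimpleGraph V} {r k : ℕ} {x : V → ℝ} {α : ℝ} {A S U : Finset V}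

/-- Every weight on `U` of total at most `r` has more than a fraction `(α - 1) / α` of its mass on
an induced cluster graph. This is what a locally feasible point with entries below `1 / α`
says about the graph, so it excludes all small structures that are expensive to hit. -/
def HasHeavyClusters (G : SimpleGraph V) (U : Finset V) (r : ℕ) (α : ℝ) : Prop :=
  ∀ c : V → ℕ, 0 < ∑ v ∈ U, c v → ∑ v ∈ U, c v ≤ r →
    ∃ S ⊆ U, P3Free G S ∧ (α - 1) * ∑ v ∈ U, (c v : ℝ) < α * ∑ v ∈ S, (c v : ℝ)

theorem LocallyFeasible.hasHeavyClusters (hx : LocallyFeasible G r x)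
    (hU : ∀ v ∈ U, α * x v < 1) : HasHeavyClusters G U r α := by
  intro c hpos hr
  by_contra! hlight
  have hcard : #{v ∈ U | c v ≠ 0} ≤ r := by
    refine le_trans ?_ ((sum_le_sum_of_subset (filter_subset (c · ≠ 0) U)).trans hr)
    simpa using card_nsmul_le_sum _ c 1 fun v hv => Nat.one_le_iff_ne_zero.2 (mem_filter.1 hv).2
  have hfeasible : ∑ v ∈ U, α * c v * (1 - x v) ≤ (α - 1) * ∑ v ∈ U, (c v : ℝ) := by
    refine hx.sum_mul_one_sub_le (filter_subset (c · ≠ 0) U) hcard (fun v hv hcv => ?_)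
      fun S hSU hS => ?_
    · have : c v = 0 := by simpa [hv] using hcv
      simp [this]
    · rw [← mul_sum]
      exact hlight S hSU hS
  have hstrict : (α - 1) * ∑ v ∈ U, (c v : ℝ) < ∑ v ∈ U, α * c v * (1 - x v) := by
    obtain ⟨u, hu, hcu⟩ := exists_ne_zero_of_sum_ne_zero hpos.ne'
    have hcu : (0 : ℝ) < c u := Nat.cast_pos.2 (Nat.pos_of_ne_zero hcu)
    rw [mul_sum]
    refine sum_lt_sum (fun v hv => ?_) ⟨u, hu, ?_⟩
    · nlinarith [hU v hv, (c v).cast_nonneg (α := ℝ)]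
    · nlinarith [hU u hu]
  exact hstrict.not_ge hfeasible

theorem HasHeavyClusters.exists_length_lt_two_mul_countP [DecidableEq V]
    (hU : HasHeavyClusters G U r α) (hα : 2 ≤ α) {l : List V} (hl : l ≠ []) (hlU : ∀ v ∈ l, v ∈ U)
    (hr : l.length ≤ r) : ∃ S, P3Free G S ∧ l.length < 2 * l.countP (· ∈ S) := by
  have hcount : ∀ (S : Finset V) (l : List V), ∑ v ∈ S, l.count v = l.countP (· ∈ S) := by
    intro S l
    induction l with
    | nil => simp
    | cons a l ih => simp [List.count_cons, List.countP_cons, sum_add_distrib, ih]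
  have hlength : ∑ v ∈ U, l.count v = l.length := by
    rw [hcount, List.countP_eq_length.2 (by simpa using hlU)]
  obtain ⟨S, -, hS, hlt⟩ := hU l.count (by rw [hlength]; exact List.length_pos_iff.2 hl)
    (by rwa [hlength])
  refine ⟨S, hS, ?_⟩
  have hle : ∑ v ∈ S, (l.count v : ℝ) ≤ l.length := by
    rw [← Nat.cast_sum, hcount]
    exact_mod_cast List.countP_le_length
  rw [← Nat.cast_sum, hlength] at hlt
  rw [← hcount]
  have hmajority : (l.length : ℝ) < 2 * ∑ v ∈ S, (l.count v : ℝ) := by nlinarith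
  exact_mod_cast hmajority

theorem HasHeavyClusters.exists_add_two_le_sum (hU : HasHeavyClusters G U r α)
    (hk : 1 ≤ (α - 2) * k) (hr : 2 * k + 1 ≤ r) {c : V → ℕ} (hc : ∑ v ∈ U, c v = 2 * k + 1) :
    ∃ S ⊆ U, P3Free G S ∧ k + 2 ≤ ∑ v ∈ S, c v := by
  obtain ⟨S, hSU, hS, hlt⟩ := hU c (by omega) (by omega)
  refine ⟨S, hSU, hS, ?_⟩
  by_contra! hlight
  have hlight' : ∑ v ∈ S, (c v : ℝ) ≤ k + 1 := by exact_mod_cast Nat.lt_succ_iff.1 hlight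
  rw [← Nat.cast_sum, hc] at hlt
  push_cast at hlt
  have hα : 0 ≤ α := by
    by_contra! hα
    nlinarith [k.cast_nonneg (α := ℝ)]
  nlinarith

/-- `u`, `v`, `w` induce a path with middle vertex `v`. -/
def IsP3 (G : SimpleGraph V) (u v w : V) : Prop :=
  G.Adj u v ∧ G.Adj v w ∧ u ≠ w ∧ ¬ G.Adj u w

/-- `a`, `b`, `c`, `d` induce, in this cyclic order, a cycle on four vertices. -/
def IsC4 (G : SimpleGraph V) (a b c d : V) : Prop :=
  IsP3 G a b c ∧ IsP3 G b c d ∧ IsP3 G c d a ∧ IsP3 G d a b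

/-- `a`, `b`, `c`, `d`, `e` induce, in this cyclic order, a cycle on five vertices. -/
def IsC5 (G : SimpleGraph V) (a b c d e : V) : Prop :=
  IsP3 G a b c ∧ IsP3 G b c d ∧ IsP3 G c d e ∧ IsP3 G d e a ∧ IsP3 G e a b

/-- Two vertex disjoint induced paths `a₁ a₂ a₃` and `b₁ b₂ b₃` without edges between them, except
possibly `a₁ b₃` and `a₃ b₁`. -/
def IsP3Pair (G : SimpleGraph V) (a₁ a₂ a₃ b₁ b₂ b₃ : V) : Prop :=
  IsP3 G a₁ a₂ a₃ ∧ IsP3 G b₁ b₂ b₃ ∧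
    ¬ G.Adj a₁ b₁ ∧ ¬ G.Adj a₁ b₂ ∧ ¬ G.Adj a₂ b₁ ∧ ¬ G.Adj a₂ b₂ ∧ ¬ G.Adj a₂ b₃ ∧
    ¬ G.Adj a₃ b₂ ∧ ¬ G.Adj a₃ b₃

theorem P3Free.notMem_of_isP3 (hS : P3Free G S) {u v w : V} (h : IsP3 G u v w) (hu : u ∈ S)
    (hv : v ∈ S) : w ∉ S :=
  fun hw => h.2.2.2 (hS u hu v hv w hw h.1 h.2.1 h.2.2.1)

theorem HasHeavyClusters.not_isC4 (hU : HasHeavyClusters G U r α) (hα : 2 ≤ α) (hr : 4 ≤ r)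
    {a b c d : V} (ha : a ∈ U) (hb : b ∈ U) (hc : c ∈ U) (hd : d ∈ U) : ¬ IsC4 G a b c d := by
  classical
  rintro ⟨abc, bcd, cda, dab⟩
  obtain ⟨S, hS, hlt⟩ := hU.exists_length_lt_two_mul_countP hα (l := [a, b, c, d]) (by simp)
    (by simp [*]) hr
  have habc := hS.notMem_of_isP3 abc
  have hbcd := hS.notMem_of_isP3 bcd
  have hcda := hS.notMem_of_isP3 cda
  have hdab := hS.notMem_of_isP3 dab
  simp only [List.countP_cons, List.countP_nil, List.length_cons, List.length_nil] at hlt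
  grind only

theorem P3Free.notMem_of_hub (hS : P3Free G S) {o u w : V} (hou : G.Adj o u) (how : G.Adj o w)
    (huw : u ≠ w ∧ ¬ G.Adj u w) (ho : o ∈ S) (hu : u ∈ S) : w ∉ S :=
  hS.notMem_of_isP3 ⟨hou.symm, how, huw⟩ hu ho

theorem HasHeavyClusters.not_isC5 (hU : HasHeavyClusters G U r α) (hα : 2 ≤ α) (hr : 6 ≤ r)
    {o a b c d e : V} (ho : o ∈ U) (hhub : ∀ v ∈ [a, b, c, d, e], v ∈ U ∧ G.Adj o v) :
    ¬ IsC5 G a b c d e := by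
  classical
  rintro ⟨abc, bcd, cde, dea, eab⟩
  obtain ⟨S, hS, hlt⟩ := hU.exists_length_lt_two_mul_countP hα (l := [o, a, b, c, d, e]) (by simp)
    (by grind) hr
  simp only [List.forall_mem_cons] at hhub
  obtain ⟨⟨-, oa⟩, ⟨-, ob⟩, ⟨-, oc⟩, ⟨-, od⟩, ⟨-, oe⟩, -⟩ := hhub
  have habc := hS.notMem_of_isP3 abc
  have hbcd := hS.notMem_of_isP3 bcd
  have hcde := hS.notMem_of_isP3 cde
  have hdea := hS.notMem_of_isP3 dea
  have heab := hS.notMem_of_isP3 eab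
  have hac := hS.notMem_of_hub oa oc abc.2.2
  have hbd := hS.notMem_of_hub ob od bcd.2.2
  have hce := hS.notMem_of_hub oc oe cde.2.2
  have hda := hS.notMem_of_hub od oa dea.2.2
  have heb := hS.notMem_of_hub oe ob eab.2.2
  simp only [List.countP_cons, List.countP_nil, List.length_cons, List.length_nil] at hlt
  grind only

theorem HasHeavyClusters.not_isP3Pair (hU : HasHeavyClusters G U r α) (hα : 2 ≤ α) (hr : 8 ≤ r)
    {o a₁ a₂ a₃ b₁ b₂ b₃ : V} (ho : o ∈ U)
    (hhub : ∀ v ∈ [a₁, a₂, a₃, b₁, b₂, b₃], v ∈ U ∧ G.Adj o v) :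
    ¬ IsP3Pair G a₁ a₂ a₃ b₁ b₂ b₃ := by
  classical
  rintro ⟨ha, hb, n11, n12, n21, n22, n23, n32, n33⟩
  obtain ⟨S, hS, hlt⟩ := hU.exists_length_lt_two_mul_countP hα
    (l := [o, o, a₁, a₂, a₃, b₁, b₂, b₃]) (by simp) (by grind) hr
  simp only [List.forall_mem_cons] at hhub
  obtain ⟨⟨-, oa₁⟩, ⟨-, oa₂⟩, ⟨-, oa₃⟩, ⟨-, ob₁⟩, ⟨-, ob₂⟩, ⟨-, ob₃⟩, -⟩ := hhub
  have hpath_a := hS.notMem_of_isP3 ha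
  have hpath_b := hS.notMem_of_isP3 hb
  have h_a := hS.notMem_of_hub oa₁ oa₃ ha.2.2
  have h_b := hS.notMem_of_hub ob₁ ob₃ hb.2.2
  have h11 := hS.notMem_of_hub oa₁ ob₁ ⟨fun e => n21 (e ▸ ha.1.symm), n11⟩
  have h12 := hS.notMem_of_hub oa₁ ob₂ ⟨fun e => n22 (e ▸ ha.1.symm), n12⟩
  have h21 := hS.notMem_of_hub oa₂ ob₁ ⟨fun e => n11 (e ▸ ha.1), n21⟩
  have h22 := hS.notMem_of_hub oa₂ ob₂ ⟨fun e => n12 (e ▸ ha.1), n22⟩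
  have h23 := hS.notMem_of_hub oa₂ ob₃ ⟨fun e => n22 (e ▸ hb.2.1.symm), n23⟩
  have h32 := hS.notMem_of_hub oa₃ ob₂ ⟨fun e => n22 (e ▸ ha.2.1), n32⟩
  have h33 := hS.notMem_of_hub oa₃ ob₃ ⟨fun e => n23 (e ▸ ha.2.1), n33⟩
  simp only [List.countP_cons, List.countP_nil, List.length_cons, List.length_nil] at hlt
  grind only

end HeavyClusters

section SeparatingWeights

open Finset

variable {α β : Type*} {rel : β → α → Prop} {Z : Finset β} {C C₀ C₁ D : Finset α}
  {w w₀ w₁ : β → ℕ} {z : β}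

/-- `z` is related to some, but not to all elements of `C`. -/
def Splits (rel : β → α → Prop) (z : β) (C : Finset α) : Prop :=
  (∃ u ∈ C, rel z u) ∧ ∃ v ∈ C, ¬ rel z v

theorem Splits.mono (h : Splits rel z C) (hCD : C ⊆ D) : Splits rel z D :=
  ⟨h.1.imp fun _ hu => ⟨hCD hu.1, hu.2⟩, h.2.imp fun _ hv => ⟨hCD hv.1, hv.2⟩⟩

/-- Weights on the elements of `Z` that separate the elements of `C`: a subset `D` of `C` and
elements that do not split `D` weigh at most `#C` together, where each element of `C` has weight
one. The total weight `#C - 1` of `Z` is that of the inner nodes of a binary tree with leaf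
set `C`. -/
structure IsSeparatingWeight (rel : β → α → Prop) (Z : Finset β) (C : Finset α) (w : β → ℕ) :
    Prop where
  eq_zero_of_notMem : ∀ z ∉ Z, w z = 0
  sum_add_one : ∑ z ∈ Z, w z + 1 = #C
  card_add_sum_le : ∀ D ⊆ C, ∀ T, (∀ z ∈ T, ¬ Splits rel z D) → #D + ∑ z ∈ T, w z ≤ #C

theorem IsSeparatingWeight.sum_add_one_le (h : IsSeparatingWeight rel Z C w) (T : Finset β) :
    ∑ z ∈ T, w z + 1 ≤ #C := by
  rw [← h.sum_add_one]
  gcongr 1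
  exact sum_le_sum_of_ne_zero fun z _ hz => not_imp_comm.1 (h.eq_zero_of_notMem z) hz

theorem isSeparatingWeight_zero (hC : #C = 1) : IsSeparatingWeight rel Z C 0 where
  eq_zero_of_notMem := by simp
  sum_add_one := by simp [hC]
  card_add_sum_le D hD T _ := by simpa using card_le_card hD

theorem IsSeparatingWeight.glue [DecidableEq α] [DecidableEq β]
    (h₁ : IsSeparatingWeight rel Z C₁ w₁) (h₀ : IsSeparatingWeight rel Z C₀ w₀) (hz : z ∈ Z)
    (hz₁ : ∀ u ∈ C₁, rel z u) (hz₀ : ∀ u ∈ C₀, ¬ rel z u) :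
    IsSeparatingWeight rel Z (C₁ ∪ C₀) (w₁ + w₀ + Pi.single z 1) := by
  have hdisj : Disjoint C₁ C₀ :=
    Finset.disjoint_left.2 fun u hu hu' => hz₀ u hu' (hz₁ u hu)
  refine ⟨fun t ht => ?_, ?_, fun D hD T hT => ?_⟩
  · have hne : t ≠ z := fun e => ht (e ▸ hz)
    simp [h₁.eq_zero_of_notMem t ht, h₀.eq_zero_of_notMem t ht, hne]
  · have hsum₁ := h₁.sum_add_one
    have hsum₀ := h₀.sum_add_one
    simp only [Pi.add_apply, sum_add_distrib, sum_pi_single', hz, if_true,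
      card_union_of_disjoint hdisj]
    omega
  · have hcard : #(D ∩ C₁) + #(D ∩ C₀) = #D := by
      rw [← card_union_of_disjoint (hdisj.mono inter_subset_right inter_subset_right),
        ← inter_union_distrib_left, inter_eq_left.2 hD]
    have hle₁ := h₁.card_add_sum_le (D ∩ C₁) inter_subset_right T fun t ht hs =>
      hT t ht (hs.mono inter_subset_left)
    have hle₀ := h₀.card_add_sum_le (D ∩ C₀) inter_subset_right T fun t ht hs =>
      hT t ht (hs.mono inter_subset_left)
    simp only [Pi.add_apply, sum_add_distrib, sum_pi_single', card_union_of_disjoint hdisj]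
    by_cases hzT : z ∈ T
    · have hempty : D ∩ C₁ = ∅ ∨ D ∩ C₀ = ∅ := by
        by_contra! hne
        obtain ⟨⟨u, hu⟩, v, hv⟩ := hne
        rw [mem_inter] at hu hv
        exact hT z hzT ⟨⟨u, hu.1, hz₁ u hu.2⟩, v, hv.1, hz₀ v hv.2⟩
      have hsum₁ := h₁.sum_add_one_le T
      have hsum₀ := h₀.sum_add_one_le T
      rw [if_pos hzT]
      rcases hempty with h | h <;> rw [h, card_empty] at hcard <;> omega
    · rw [if_neg hzT]
      omega

theorem exists_isSeparatingWeight (hC : C.Nonempty)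
    (hZ : ∀ u ∈ C, ∀ v ∈ C, u ≠ v → ∃ z ∈ Z, ¬ (rel z u ↔ rel z v)) :
    ∃ w, IsSeparatingWeight rel Z C w := by
  classical
  induction C using Finset.strongInduction with
  | H C ih =>
    obtain hC1 | hC1 := (Nat.one_le_iff_ne_zero.2 hC.card_pos.ne').eq_or_lt
    · exact ⟨0, isSeparatingWeight_zero hC1.symm⟩
    · obtain ⟨u, hu, v, hv, huv⟩ := one_lt_card.1 hC1
      obtain ⟨z, hz, hsep⟩ := hZ u hu v hv huv
      obtain ⟨⟨a, ha, hza⟩, b, hb, hzb⟩ : Splits rel z C := by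
        by_cases hzu : rel z u
        · exact ⟨⟨u, hu, hzu⟩, v, hv, fun hzv => hsep (iff_of_true hzu hzv)⟩
        · exact ⟨⟨v, hv, by_contra fun hzv => hsep (iff_of_false hzu hzv)⟩, u, hu, hzu⟩
      have hpart : ∀ (p : α → Prop) [DecidablePred p], ∀ a ∈ C, p a → ∀ b ∈ C, ¬ p b →
          ∃ w, IsSeparatingWeight rel Z {t ∈ C | p t} w := fun p _ a ha hpa b hb hpb =>
        ih _ (filter_ssubset.2 ⟨b, hb, hpb⟩) ⟨a, mem_filter.2 ⟨ha, hpa⟩⟩ fun u hu v hv =>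
          hZ u (mem_of_mem_filter u hu) v (mem_of_mem_filter v hv)
      obtain ⟨w₁, h₁⟩ := hpart (rel z) a ha hza b hb hzb
      obtain ⟨w₀, h₀⟩ := hpart (¬ rel z ·) b hb hzb a ha (not_not.2 hza)
      have hglue := h₁.glue h₀ hz (fun u hu => (mem_filter.1 hu).2) fun u hu => (mem_filter.1 hu).2
      rw [filter_union_filter_not_eq] at hglue
      exact ⟨_, hglue⟩

end SeparatingWeights

section NeighborhoodBound

open Finset

variable {V : Type*} {G : SimpleGraph V} {r k ω : ℕ} {α : ℝ} {A C I K S U Z : Finset V} {w : V → ℕ}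
  {i o : V}

theorem IsSeparatingWeight.card_inter_add_sum_le [DecidableEq V]
    (h : IsSeparatingWeight G.Adj Z C w) (hC : G.IsClique C) (hZC : Disjoint Z C)
    (hS : P3Free G S) : #(S ∩ C) + ∑ v ∈ S, w v ≤ #C := by
  have hsum : ∑ v ∈ S, w v = ∑ v ∈ S ∩ Z, w v := by
    refine (sum_subset inter_subset_left fun v hvS hv => h.eq_zero_of_notMem v fun hvZ => ?_).symm
    exact hv (mem_inter.2 ⟨hvS, hvZ⟩)
  rw [hsum]
  refine h.card_add_sum_le _ inter_subset_right _ ?_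
  rintro z hz ⟨⟨u, hu, hzu⟩, v, hv, hzv⟩
  rw [mem_inter] at hz hu hv
  have huv : G.Adj u v := hC hu.2 hv.2 fun e => hzv (e ▸ hzu)
  exact hzv (hS z hz.1 u hu.1 v hv.1 hzu huv (hZC.forall_ne_finset hz.2 hv.2))

/-- Any two adjacent vertices of `U` are distinguished by a third vertex of `U`. -/
def TwinFree (G : SimpleGraph V) (U : Finset V) : Prop :=
  ∀ u ∈ U, ∀ v ∈ U, G.Adj u v → ∃ z ∈ U, z ≠ u ∧ z ≠ v ∧ ¬ (G.Adj z u ↔ G.Adj z v)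

theorem TwinFree.exists_isSeparatingWeight [DecidableEq V] (hU : TwinFree G U) (hKU : K ⊆ U)
    (hK : G.IsClique K) (hne : K.Nonempty) : ∃ w, IsSeparatingWeight G.Adj (U \ K) K w := by
  refine _root_.exists_isSeparatingWeight hne fun u hu v hv huv => ?_
  obtain ⟨z, hz, hzu, hzv, hsep⟩ := hU u (hKU hu) v (hKU hv) (hK hu hv huv)
  refine ⟨z, mem_sdiff.2 ⟨hz, fun hzK => hsep ?_⟩, hsep⟩
  exact iff_of_true (hK hzK hu hzu) (hK hzK hv hzv)

theorem HasHeavyClusters.card_le_of_isClique (hU : HasHeavyClusters G U r α) (htwin : TwinFree G U)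
    (hk : 1 ≤ (α - 2) * k) (hr : 2 * k + 1 ≤ r) (hKU : K ⊆ U) (hK : G.IsClique K) : #K ≤ k := by
  classical
  by_contra! hlt
  obtain ⟨C, hCK, hCcard⟩ := exists_subset_card_eq (Nat.add_one_le_iff.2 hlt)
  have hC : G.IsClique C := hK.subset (coe_subset.2 hCK)
  have hCU := hCK.trans hKU
  obtain ⟨w, hw⟩ := htwin.exists_isSeparatingWeight hCU hC (card_pos.1 (by omega))
  have hsum : ∀ S : Finset V,
      ∑ v ∈ S, ((if v ∈ C then 1 else 0) + w v) = #(S ∩ C) + ∑ v ∈ S, w v := by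
    simp [sum_add_distrib]
  have htotal : ∑ v ∈ U, w v = k := by
    have hoff : ∀ v ∈ U, v ∉ U \ C → w v = 0 := fun v _ => hw.eq_zero_of_notMem v
    have := hw.sum_add_one
    rw [sum_subset sdiff_subset hoff] at this
    omega
  obtain ⟨S, -, hS, hheavy⟩ := hU.exists_add_two_le_sum hk hr
    (c := fun v => (if v ∈ C then 1 else 0) + w v)
    (by rw [hsum, htotal, inter_eq_right.2 hCU]; omega)
  rw [hsum] at hheavy
  have := hw.card_inter_add_sum_le hC sdiff_disjoint hS
  omega

theorem HasHeavyClusters.card_le_of_isIndepSet (hU : HasHeavyClusters G U r α)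
    (hk : 1 ≤ (α - 2) * k) (hr : 2 * k + 1 ≤ r) (ho : o ∈ U) (hIU : I ⊆ U)
    (hoI : ∀ v ∈ I, G.Adj o v) (hI : G.IsIndepSet I) : #I ≤ k := by
  classical
  by_contra! hlt
  obtain ⟨C, hCI, hCcard⟩ := exists_subset_card_eq (Nat.add_one_le_iff.2 hlt)
  have hsum : ∀ S : Finset V, ∑ v ∈ S, ((if v ∈ C then 1 else 0) + (Pi.single o k : V → ℕ) v) =
      #(S ∩ C) + if o ∈ S then k else 0 := by
    simp [sum_add_distrib]
  obtain ⟨S, -, hS, hheavy⟩ := hU.exists_add_two_le_sum hk hr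
    (c := fun v => (if v ∈ C then 1 else 0) + (Pi.single o k : V → ℕ) v)
    (by rw [hsum, if_pos ho, inter_eq_right.2 (hCI.trans hIU)]; omega)
  rw [hsum] at hheavy
  have hcard : #(S ∩ C) ≤ k + 1 := hCcard ▸ card_le_card inter_subset_right
  split_ifs at hheavy with hoS
  · obtain ⟨u, hu, v, hv, huv⟩ := one_lt_card.1 (show 1 < #(S ∩ C) by omega)
    rw [mem_inter] at hu hv
    have hou := hoI u (hCI hu.2)
    have hov := hoI v (hCI hv.2)
    exact hI (hCI hu.2) (hCI hv.2) huv (hS u hu.1 o hoS v hv.1 hou.symm hov huv)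
  · omega

open Classical in
/-- The vertices of `A` whose closed neighborhood meets `I` in `i` only. -/
noncomputable def privateNbrs (G : SimpleGraph V) (A I : Finset V) (i : V) : Finset V :=
  {a ∈ A | ∀ j ∈ I, a = j ∨ G.Adj a j ↔ j = i}

open Classical in
/-- The vertices of `A` that are adjacent to both `i` and `j`. -/
noncomputable def commonNbrs (G : SimpleGraph V) (A : Finset V) (i j : V) : Finset V :=
  {a ∈ A | G.Adj a i ∧ G.Adj a j}

theorem isIndepSet_insert_of_forall_not_adj [DecidableEq V] {a : V} (hI : G.IsIndepSet I)
    (ha : ∀ j ∈ I, ¬ G.Adj a j) : G.IsIndepSet (insert a I : Finset V) := by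
  rw [← SimpleGraph.isClique_compl] at hI ⊢
  rw [coe_insert]
  exact hI.insert fun j hj haj => (G.compl_adj a j).2 ⟨haj, ha j hj⟩

theorem isClique_privateNbrs (hIA : I ⊆ A) (hI : G.IsIndepSet I)
    (hmax : ∀ J ⊆ A, G.IsIndepSet J → #J ≤ #I) (hi : i ∈ I) :
    G.IsClique (privateNbrs G A I i) := by
  classical
  intro a ha b hb hab
  by_contra hn
  obtain ⟨haA, ha⟩ := mem_filter.1 ha
  obtain ⟨hbA, hb⟩ := mem_filter.1 hb
  have hmiss : ∀ t, (∀ j ∈ I, t = j ∨ G.Adj t j ↔ j = i) → ∀ j ∈ I.erase i,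
      t ≠ j ∧ ¬ G.Adj t j := fun t ht j hj =>
    not_or.1 fun h => ne_of_mem_erase hj ((ht j (mem_of_mem_erase hj)).1 h)
  have haI : a ∉ insert b (I.erase i) := by
    rw [mem_insert, not_or]
    exact ⟨hab, fun h => (hmiss a ha a h).1 rfl⟩
  have hbI : b ∉ I.erase i := fun h => (hmiss b hb b h).1 rfl
  have hindep : G.IsIndepSet (insert a (insert b (I.erase i)) : Finset V) := by
    refine isIndepSet_insert_of_forall_not_adj (isIndepSet_insert_of_forall_not_adj
      (hI.mono (coe_subset.2 (erase_subset i I))) fun j hj => (hmiss b hb j hj).2) ?_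
    rw [forall_mem_insert]
    exact ⟨hn, fun j hj => (hmiss a ha j hj).2⟩
  have hle := hmax _ (insert_subset haA (insert_subset hbA ((erase_subset _ _).trans hIA))) hindep
  rw [card_insert_of_notMem haI, card_insert_of_notMem hbI, card_erase_of_mem hi] at hle
  have := card_pos.2 ⟨i, hi⟩
  omega

theorem isClique_commonNbrs (hC4 : ∀ a ∈ A, ∀ b ∈ A, ∀ c ∈ A, ∀ d ∈ A, ¬ IsC4 G a b c d)
    {i j : V} (hi : i ∈ A) (hj : j ∈ A) (hij : i ≠ j) (hn : ¬ G.Adj i j) :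
    G.IsClique (commonNbrs G A i j) := by
  classical
  intro a ha b hb hab
  by_contra hnab
  obtain ⟨haA, hai, haj⟩ := mem_filter.1 ha
  obtain ⟨hbA, hbi, hbj⟩ := mem_filter.1 hb
  exact hC4 a haA i hi b hbA j hj ⟨⟨hai, hbi.symm, hab, hnab⟩, ⟨hbi.symm, hbj, hij, hn⟩,
    ⟨hbj, haj.symm, hab.symm, fun h => hnab h.symm⟩, haj.symm, hai, hij.symm, fun h => hn h.symm⟩

theorem exists_mem_privateNbrs_or_commonNbrs (hI : G.IsIndepSet I)
    (hmax : ∀ J ⊆ A, G.IsIndepSet J → #J ≤ #I) (hIA : I ⊆ A) {a : V} (ha : a ∈ A) :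
    (∃ i ∈ I, a ∈ privateNbrs G A I i) ∨
      ∃ i ∈ I, ∃ j ∈ I, i ≠ j ∧ a ∈ commonNbrs G A i j := by
  classical
  by_cases haI : a ∈ I
  · refine .inl ⟨a, haI, mem_filter.2 ⟨ha, fun j hj => ?_⟩⟩
    have hn : ¬ G.Adj a j := fun h => hI haI hj h.ne h
    simp [hn, eq_comm]
  obtain ⟨i, hi, hai⟩ : ∃ i ∈ I, G.Adj a i := by
    by_contra! hno
    have hle := hmax _ (insert_subset ha hIA) (isIndepSet_insert_of_forall_not_adj hI hno)
    rw [card_insert_of_notMem haI] at hle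
    omega
  by_cases hother : ∃ j ∈ I, i ≠ j ∧ G.Adj a j
  · obtain ⟨j, hj, hij, haj⟩ := hother
    exact .inr ⟨i, hi, j, hj, hij, mem_filter.2 ⟨ha, hai, haj⟩⟩
  · refine .inl ⟨i, hi, mem_filter.2 ⟨ha, fun j hj => ⟨fun h => ?_, fun h => .inr (h ▸ hai)⟩⟩⟩
    obtain rfl | haj := h
    · exact absurd hj haI
    · by_contra hji
      exact hother ⟨j, hj, Ne.symm hji, haj⟩

theorem card_le_of_forall_not_isC4 {m : ℕ} (hclique : ∀ K ⊆ A, G.IsClique K → #K ≤ ω)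
    (hindep : ∀ I ⊆ A, G.IsIndepSet I → #I ≤ m)
    (hC4 : ∀ a ∈ A, ∀ b ∈ A, ∀ c ∈ A, ∀ d ∈ A, ¬ IsC4 G a b c d) : #A ≤ m ^ 2 * ω := by
  classical
  obtain ⟨I, hI, hmax⟩ := exists_max_image
    (A.powerset.filter fun I : Finset V => G.IsIndepSet (I : Set V)) card ⟨∅, by simp⟩
  simp only [mem_filter, mem_powerset, and_imp] at hI hmax
  obtain ⟨hIA, hI⟩ := hI
  have hcover : A ⊆ I.biUnion (privateNbrs G A I) ∪
      I.offDiag.biUnion fun p => commonNbrs G A p.1 p.2 := by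
    intro a ha
    simpa [and_assoc] using exists_mem_privateNbrs_or_commonNbrs hI hmax hIA ha
  have hprivate : ∀ i ∈ I, #(privateNbrs G A I i) ≤ ω := fun i hi =>
    hclique _ (filter_subset _ _) (isClique_privateNbrs hIA hI hmax hi)
  have hcommon : ∀ p ∈ I.offDiag, #(commonNbrs G A p.1 p.2) ≤ ω := by
    rintro ⟨i, j⟩ hp
    obtain ⟨hi, hj, hij⟩ := mem_offDiag.1 hp
    exact hclique _ (filter_subset _ _)
      (isClique_commonNbrs hC4 (hIA hi) (hIA hj) hij (hI hi hj hij))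
  calc #A ≤ #I * ω + #I.offDiag * ω :=
        (card_le_card hcover).trans <| (card_union_le _ _).trans <|
          add_le_add (card_biUnion_le_card_mul _ _ _ hprivate)
            (card_biUnion_le_card_mul _ _ _ hcommon)
    _ = #I ^ 2 * ω := by
        rw [← add_mul, offDiag_card, Nat.add_sub_cancel' (Nat.le_mul_self _), sq]
    _ ≤ m ^ 2 * ω := by gcongr; exact hindep I hIA hI

end NeighborhoodBound

section HittingClique

open Finset

variable {V : Type*} {G : SimpleGraph V} {A C D K S : Finset V} {p : ℕ → V} {m : ℕ} {c k : V}

theorem not_p3Free_iff : ¬ P3Free G S ↔ ∃ u ∈ S, ∃ v ∈ S, ∃ w ∈ S, IsP3 G u v w := by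
  simp only [P3Free, IsP3, not_forall, exists_prop]

/-- The subgraph induced by `A` contains no four-cycle, no five-cycle, and no pair of paths on
three vertices as in `IsP3Pair`. -/
structure PatternFree (G : SimpleGraph V) (A : Finset V) : Prop where
  not_isC4 : ∀ a ∈ A, ∀ b ∈ A, ∀ c ∈ A, ∀ d ∈ A, ¬ IsC4 G a b c d
  not_isC5 : ∀ a ∈ A, ∀ b ∈ A, ∀ c ∈ A, ∀ d ∈ A, ∀ e ∈ A, ¬ IsC5 G a b c d e
  not_isP3Pair : ∀ a₁ ∈ A, ∀ a₂ ∈ A, ∀ a₃ ∈ A, ∀ b₁ ∈ A, ∀ b₂ ∈ A, ∀ b₃ ∈ A,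
    ¬ IsP3Pair G a₁ a₂ a₃ b₁ b₂ b₃

theorem exists_gap {P : ℕ → Prop} {m i : ℕ} (h0 : P 0) (hm : P m) (him : i ≤ m) (hi : ¬ P i) :
    ∃ a b, a + 2 ≤ b ∧ b ≤ m ∧ P a ∧ P b ∧ ∀ j, a < j → j < b → ¬ P j := by
  classical
  have hex : ∃ b, i ≤ b ∧ P b := ⟨m, him, hm⟩
  have ha : P (Nat.findGreatest P i) := Nat.findGreatest_spec (Nat.zero_le i) h0
  obtain ⟨hib, hb⟩ := Nat.find_spec hex
  have hai : Nat.findGreatest P i < i :=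
    (Nat.findGreatest_le i).lt_of_ne fun e => hi (e ▸ ha)
  have hib : i < Nat.find hex := hib.lt_of_ne fun e => hi (e ▸ hb)
  refine ⟨_, _, by omega, Nat.find_min' hex ⟨him, hm⟩, ha, hb, fun j haj hjb hj => ?_⟩
  obtain hji | hij := le_total j i
  · exact Nat.findGreatest_is_greatest haj hji hj
  · exact Nat.find_min hex hjb ⟨hij, hj⟩

/-- The sequence `p 0, …, p m` is an induced path of `G`. -/
structure IsInducedPath (G : SimpleGraph V) (p : ℕ → V) (m : ℕ) : Prop where
  adj_succ : ∀ i < m, G.Adj (p i) (p (i + 1))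
  ne_and_not_adj : ∀ i j, i + 2 ≤ j → j ≤ m → p i ≠ p j ∧ ¬ G.Adj (p i) (p j)

theorem exists_isInducedPath {a b : V} (h : G.Reachable a b) :
    ∃ (m : ℕ) (p : ℕ → V), p 0 = a ∧ p m = b ∧ IsInducedPath G p m := by
  obtain ⟨w, hw⟩ := h.exists_walk_length_eq_dist
  refine ⟨w.length, w.getVert, w.getVert_zero, w.getVert_length,
    fun i hi => w.adj_getVert_succ hi, fun i j hij hj => ⟨fun e => ?_, fun e => ?_⟩⟩
  · have := SimpleGraph.dist_le ((w.take i).append ((w.drop j).copy e.symm rfl))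
    rw [SimpleGraph.Walk.length_append, SimpleGraph.Walk.length_copy,
      SimpleGraph.Walk.take_length, SimpleGraph.Walk.drop_length] at this
    omega
  · have := SimpleGraph.dist_le ((w.take i).append (SimpleGraph.Walk.cons e (w.drop j)))
    rw [SimpleGraph.Walk.length_append, SimpleGraph.Walk.length_cons,
      SimpleGraph.Walk.take_length, SimpleGraph.Walk.drop_length] at this
    omega

theorem IsInducedPath.map {W : Type*} {H : SimpleGraph W} (hp : IsInducedPath G p m)
    (f : G ↪g H) : IsInducedPath H (f ∘ p) m where
  adj_succ i hi := f.map_adj_iff.2 (hp.adj_succ i hi)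
  ne_and_not_adj i j hij hj := (hp.ne_and_not_adj i j hij hj).imp f.injective.ne
    (mt f.map_adj_iff.1)

theorem IsInducedPath.isP3 (hp : IsInducedPath G p m) {i : ℕ} (hi : i + 2 ≤ m) :
    IsP3 G (p i) (p (i + 1)) (p (i + 2)) :=
  ⟨hp.adj_succ i (by omega), hp.adj_succ (i + 1) (by omega), hp.ne_and_not_adj i _ le_rfl hi⟩

/-- Consecutive neighbors of `k` on the path that are two, three, or at least four steps apart
give a four-cycle, a five-cycle, or a pair of paths on three vertices, respectively. -/
theorem IsInducedPath.adj_of_adj_ends (hp : IsInducedPath G p m) (hA : PatternFree G A)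
    (hpA : ∀ i ≤ m, p i ∈ A) (hkA : k ∈ A) (hkp : ∀ i ≤ m, k ≠ p i) (h0 : G.Adj k (p 0))
    (hm : G.Adj k (p m)) : ∀ i ≤ m, G.Adj k (p i) := by
  by_contra! ⟨i, him, hi⟩
  obtain ⟨a, b, hab, hbm, ha, hb, hgap⟩ := exists_gap (P := fun i => G.Adj k (p i)) h0 hm him hi
  have hmem : ∀ j ≤ b, p j ∈ A := fun j hj => hpA j (hj.trans hbm)
  have hfar : ∀ i j, i + 2 ≤ j → j ≤ b → ¬ G.Adj (p i) (p j) := fun i j hij hj =>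
    (hp.ne_and_not_adj i j hij (hj.trans hbm)).2
  have hleave : IsP3 G k (p a) (p (a + 1)) :=
    ⟨ha, hp.adj_succ a (by omega), hkp _ (by omega), hgap (a + 1) (by omega) (by omega)⟩
  have hskip : IsP3 G (p b) k (p a) := by
    obtain ⟨hne, hn⟩ := hp.ne_and_not_adj a b hab hbm
    exact ⟨hb.symm, ha, hne.symm, fun h => hn h.symm⟩
  have hreturn : ∀ j, j + 1 = b → a < j → IsP3 G (p j) (p b) k := by
    rintro j rfl haj
    exact ⟨hp.adj_succ j (by omega), hb.symm, (hkp j (by omega)).symm,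
      fun h => hgap j haj (by omega) h.symm⟩
  obtain rfl | rfl | hab : b = a + 2 ∨ b = a + 3 ∨ a + 4 ≤ b := by omega
  · exact hA.not_isC4 k hkA _ (hmem a (by omega)) _ (hmem (a + 1) (by omega)) _ (hmem _ le_rfl)
      ⟨hleave, hp.isP3 hbm, hreturn _ rfl (by omega), hskip⟩
  · exact hA.not_isC5 k hkA _ (hmem a (by omega)) _ (hmem (a + 1) (by omega)) _
      (hmem (a + 2) (by omega)) _ (hmem _ le_rfl)
      ⟨hleave, hp.isP3 (by omega), hp.isP3 hbm, hreturn _ rfl (by omega), hskip⟩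
  · exact hA.not_isP3Pair k hkA _ (hmem a (by omega)) _ (hmem (a + 1) (by omega)) _
      (hmem (a + 2) (by omega)) _ (hmem (a + 3) (by omega)) _ (hmem (a + 4) (by omega))
      ⟨hleave, hp.isP3 (by omega), hgap _ (by omega) (by omega), hgap _ (by omega) (by omega),
        hfar _ _ (by omega) (by omega), hfar _ _ (by omega) (by omega),
        hfar _ _ (by omega) (by omega), hfar _ _ (by omega) (by omega),
        hfar _ _ (by omega) (by omega)⟩

theorem exists_isInducedPath_of_preconnected_induce {d : V}
    (hC : (G.induce (C : Set V)).Preconnected) (hc : c ∈ C) (hd : d ∈ C) (hk : k ∉ C)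
    (hdk : G.Adj d k) :
    ∃ (m : ℕ) (p : ℕ → V), p 0 = c ∧ p (m + 1) = k ∧ IsInducedPath G p (m + 1) ∧
      ∀ i ≤ m, p i ∈ C := by
  let s : Set V := insert k C
  have hCs : (C : Set V) ≤ s := Set.subset_insert k C
  have hdk : (G.induce s).Adj ⟨d, hCs hd⟩ ⟨k, Set.mem_insert k _⟩ := hdk
  have hreach : (G.induce s).Reachable ⟨c, hCs hc⟩ ⟨k, Set.mem_insert k _⟩ :=
    ((hC ⟨c, hc⟩ ⟨d, hd⟩).map (G.induceHomOfLE hCs).toHom).trans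
      hdk.reachable
  obtain ⟨m, p, hp0, hpm, hp⟩ := exists_isInducedPath hreach
  obtain _ | m := m
  · exact absurd (congr_arg Subtype.val (hp0.symm.trans hpm))
      (ne_of_mem_of_not_mem hc hk)
  refine ⟨m, _, congr_arg Subtype.val hp0, congr_arg Subtype.val hpm,
    hp.map (SimpleGraph.Embedding.induce s), fun i hi => (p i).2.resolve_left fun hik => ?_⟩
  have hend : p i = p (m + 1) := Subtype.ext (hik.trans (congr_arg Subtype.val hpm).symm)
  obtain rfl | hlt := hi.eq_or_lt
  · exact (hp.adj_succ i (by omega)).ne hend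
  · exact (hp.ne_and_not_adj i (m + 1) (by omega) le_rfl).1 hend

theorem exists_ssubset_of_not_preconnected_induce (hC : ¬ (G.induce (C : Set V)).Preconnected) :
    ∃ D ⊂ C, D.Nonempty ∧ ∀ d ∈ D, ∀ e ∈ C, G.Adj d e → e ∈ D := by
  classical
  simp only [SimpleGraph.Preconnected, not_forall] at hC
  obtain ⟨x, y, hxy⟩ := hC
  let D : Finset V := {d ∈ C | ∃ hd : d ∈ C, (G.induce (C : Set V)).Reachable x ⟨d, hd⟩}
  refine ⟨D, filter_ssubset.2 ⟨y, y.2, fun h => hxy h.2⟩,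
    ⟨x, mem_filter.2 ⟨x.2, x.2, .rfl⟩⟩, ?_⟩
  intro d hd e he hde
  obtain ⟨-, hd, hxd⟩ := mem_filter.1 hd
  refine mem_filter.2 ⟨he, he, hxd.trans (SimpleGraph.Adj.reachable ?_)⟩
  exact hde

theorem P3Free.of_sdiff [DecidableEq V] (hD : P3Free G D) (hCD : P3Free G (C \ D))
    (hclosed : ∀ d ∈ D, ∀ e ∈ C, G.Adj d e → e ∈ D) : P3Free G C := by
  intro u hu v hv w hw huv hvw
  by_cases hvD : v ∈ D
  · exact hD u (hclosed v hvD u hu huv.symm) v hvD w (hclosed v hvD w hw hvw) huv hvw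
  · exact hCD u (mem_sdiff.2 ⟨hu, fun h => hvD (hclosed u h v hv huv)⟩) v (mem_sdiff.2 ⟨hv, hvD⟩)
      w (mem_sdiff.2 ⟨hw, fun h => hvD (hclosed w h v hv hvw.symm)⟩) huv hvw

/-- `Q` is a clique that meets all induced paths on three vertices of `A`. -/
structure IsHittingClique [DecidableEq V] (G : SimpleGraph V) (A Q : Finset V) : Prop where
  subset : Q ⊆ A
  isClique : G.IsClique Q
  p3Free_sdiff : P3Free G (A \ Q)

/-- A subset `C` of `A` that is not a disjoint union of cliques and is separated from the rest of
`A` by the clique `K`. Shrinking such a set as long as possible leads to a hitting clique of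
`A`. -/
structure IsPocket (G : SimpleGraph V) (A K C : Finset V) : Prop where
  subset : C ⊆ A
  clique_subset : K ⊆ A
  isClique : G.IsClique K
  disjoint : Disjoint C K
  mem_or_mem : ∀ c ∈ C, ∀ a ∈ A, G.Adj c a → a ∈ C ∨ a ∈ K
  not_p3Free : ¬ P3Free G C

namespace IsPocket

theorem of_subset (h : IsPocket G A K C) (hDC : D ⊆ C)
    (hclosed : ∀ d ∈ D, ∀ e ∈ C, G.Adj d e → e ∈ D) (hD : ¬ P3Free G D) : IsPocket G A K D where
  subset := hDC.trans h.subset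
  clique_subset := h.clique_subset
  isClique := h.isClique
  disjoint := h.disjoint.mono_left hDC
  mem_or_mem d hd a ha hda :=
    (h.mem_or_mem d (hDC hd) a ha hda).imp_left fun haC => hclosed d hd a haC hda
  not_p3Free := hD

theorem exists_ssubset_of_not_preconnected (h : IsPocket G A K C)
    (hC : ¬ (G.induce (C : Set V)).Preconnected) : ∃ D ⊂ C, IsPocket G A K D := by
  classical
  obtain ⟨D, hDC, hne, hclosed⟩ := exists_ssubset_of_not_preconnected_induce hC
  by_cases hD : P3Free G D
  · refine ⟨C \ D, sdiff_ssubset hDC.subset hne, h.of_subset sdiff_subset (fun d hd e he hde => ?_)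
      fun hCD => h.not_p3Free (hD.of_sdiff hCD hclosed)⟩
    rw [mem_sdiff] at hd ⊢
    exact ⟨he, fun heD => hd.2 (hclosed e heD d hd.1 hde.symm)⟩
  · exact ⟨D, hDC, h.of_subset hDC.subset hclosed hD⟩

theorem exists_adj_forall_adj_of_adj (h : IsPocket G A K C) (hA : PatternFree G A)
    (hC : (G.induce (C : Set V)).Preconnected) (hc : c ∈ C) (hk : k ∈ K) {d : V} (hd : d ∈ C)
    (hdk : G.Adj d k) : ∃ e ∈ C, G.Adj e k ∧ ∀ l ∈ K, G.Adj c l → G.Adj e l := by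
  have hkC : k ∉ C := fun hkC => Finset.disjoint_left.1 h.disjoint hkC hk
  obtain ⟨m, p, hp0, hpm, hp, hpC⟩ := exists_isInducedPath_of_preconnected_induce hC hc hd hkC hdk
  have hlast : G.Adj (p m) k := hpm ▸ hp.adj_succ m m.lt_succ_self
  refine ⟨p m, hpC m le_rfl, hlast, fun l hl hcl => ?_⟩
  by_cases hlk : l = k
  · exact hlk ▸ hlast
  have hpath : ∀ i ≤ m + 1, p i ∈ A ∧ l ≠ p i := by
    intro i hi
    obtain rfl | hi := Nat.le_succ_iff_eq_or_le.1 hi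
    · exact ⟨hpm ▸ h.clique_subset hk, hpm ▸ hlk⟩
    · exact ⟨h.subset (hpC i hi), (h.disjoint.forall_ne_finset (hpC i hi) hl).symm⟩
  exact (hp.adj_of_adj_ends hA (fun i hi => (hpath i hi).1) (h.clique_subset hl)
    (fun i hi => (hpath i hi).2) (hp0 ▸ hcl.symm) (hpm ▸ h.isClique hl hk hlk) m m.le_succ).symm

theorem exists_forall_adj_of_preconnected (h : IsPocket G A K C) (hA : PatternFree G A)
    (hC : (G.induce (C : Set V)).Preconnected) :
    ∃ c ∈ C, ∀ k ∈ K, (∃ d ∈ C, G.Adj d k) → G.Adj c k := by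
  classical
  obtain ⟨u, hu, -⟩ := not_p3Free_iff.1 h.not_p3Free
  obtain ⟨c, hc, hmax⟩ := exists_max_image C (fun c => #{k ∈ K | G.Adj c k}) ⟨u, hu⟩
  refine ⟨c, hc, fun k hk ⟨d, hd, hdk⟩ => by_contra fun hck => ?_⟩
  obtain ⟨e, he, hek, hce⟩ := h.exists_adj_forall_adj_of_adj hA hC hc hk hd hdk
  have hlt : #{l ∈ K | G.Adj c l} < #{l ∈ K | G.Adj e l} := by
    refine card_lt_card (Finset.ssubset_iff_subset_ne.2 ⟨fun l hl => ?_, fun heq => ?_⟩)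
    · obtain ⟨hlK, hcl⟩ := mem_filter.1 hl
      exact mem_filter.2 ⟨hlK, hce l hlK hcl⟩
    · exact hck (mem_filter.1 (heq ▸ mem_filter.2 ⟨hk, hek⟩)).2
  exact (hmax e he).not_gt hlt

theorem p3Free_sdiff [DecidableEq V] {Q : Finset V} (h : IsPocket G A K C) (hA : PatternFree G A)
    (hQ : ∀ c ∈ C, ∀ a ∈ A \ Q, G.Adj c a → a ∈ C) (hCQ : P3Free G (C \ Q)) :
    P3Free G (A \ Q) := by
  refine hCQ.of_sdiff (by_contra fun hrest => ?_) fun c hc a ha hca => ?_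
  · obtain ⟨u, hu, v, hv, w, hw, huvw⟩ := not_p3Free_iff.1 hrest
    obtain ⟨u', hu', v', hv', w', hw', huvw'⟩ := not_p3Free_iff.1 h.not_p3Free
    have hout : ∀ a ∈ (A \ Q) \ (C \ Q), a ∈ A ∧ ∀ c ∈ C, ¬ G.Adj a c := by
      intro a ha
      obtain ⟨haQ, haC⟩ := mem_sdiff.1 ha
      refine ⟨(mem_sdiff.1 haQ).1, fun c hc hac => haC (mem_sdiff.2 ⟨?_, (mem_sdiff.1 haQ).2⟩)⟩
      exact hQ c hc a haQ hac.symm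
    obtain ⟨huA, hu⟩ := hout u hu
    obtain ⟨hvA, hv⟩ := hout v hv
    obtain ⟨hwA, hw⟩ := hout w hw
    exact hA.not_isP3Pair u huA v hvA w hwA u' (h.subset hu') v' (h.subset hv') w' (h.subset hw')
      ⟨huvw, huvw', hu u' hu', hu v' hv', hv u' hu', hv v' hv', hv w' hw', hw v' hv', hw w' hw'⟩
  · exact mem_sdiff.2 ⟨hQ c (mem_sdiff.1 hc).1 a ha hca, (mem_sdiff.1 ha).2⟩

theorem exists_isHittingClique_or_ssubset [DecidableEq V] (h : IsPocket G A K C)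
    (hA : PatternFree G A) (hc : c ∈ C) (hcK : ∀ k ∈ K, (∃ d ∈ C, G.Adj d k) → G.Adj c k) :
    ∃ Q, IsHittingClique G A Q ∨ ∃ D ⊂ C, IsPocket G A Q D := by
  classical
  let K' := {k ∈ K | ∃ d ∈ C, G.Adj d k}
  have hK' : K' ⊆ K := filter_subset _ K
  have hQA : insert c K' ⊆ A := insert_subset (h.subset hc) (hK'.trans h.clique_subset)
  have hQ : G.IsClique (insert c K' : Finset V) := by
    rw [coe_insert]
    refine (h.isClique.subset (coe_subset.2 hK')).insert fun k hk _ => ?_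
    obtain ⟨hkK, hkC⟩ := mem_filter.1 hk
    exact hcK k hkK hkC
  have hclosed : ∀ d ∈ C, ∀ a ∈ A \ insert c K', G.Adj d a → a ∈ C := by
    intro d hd a ha hda
    obtain ⟨haA, haQ⟩ := mem_sdiff.1 ha
    refine (h.mem_or_mem d hd a haA hda).resolve_right fun haK => haQ ?_
    exact mem_insert_of_mem (mem_filter.2 ⟨haK, d, hd, hda⟩)
  refine ⟨insert c K', or_iff_not_imp_left.2 fun hhit => ⟨C \ insert c K', ?_, ?_⟩⟩
  · exact ssubset_iff_subset_not_subset.2 ⟨sdiff_subset, fun hCQ =>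
      (mem_sdiff.1 (hCQ hc)).2 (mem_insert_self c K')⟩
  · refine ⟨sdiff_subset.trans h.subset, hQA, hQ, sdiff_disjoint, fun d hd a ha hda => ?_,
      fun hCQ => hhit ⟨hQA, hQ, h.p3Free_sdiff hA hclosed hCQ⟩⟩
    refine or_iff_not_imp_right.2 fun haQ => mem_sdiff.2 ⟨?_, haQ⟩
    exact hclosed d (mem_sdiff.1 hd).1 a (mem_sdiff.2 ⟨ha, haQ⟩) hda

end IsPocket

theorem IsPocket.exists_isHittingClique [DecidableEq V] (h : IsPocket G A K C)
    (hA : PatternFree G A) : ∃ Q, IsHittingClique G A Q := by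
  induction C using Finset.strongInduction generalizing K with
  | H C ih =>
    by_cases hC : (G.induce (C : Set V)).Preconnected
    · obtain ⟨c, hc, hcK⟩ := h.exists_forall_adj_of_preconnected hA hC
      obtain ⟨Q, hQ | ⟨D, hDC, hD⟩⟩ := h.exists_isHittingClique_or_ssubset hA hc hcK
      · exact ⟨Q, hQ⟩
      · exact ih D hDC hD
    · obtain ⟨D, hDC, hD⟩ := h.exists_ssubset_of_not_preconnected hC
      exact ih D hDC hD

theorem PatternFree.exists_isHittingClique [DecidableEq V] (hA : PatternFree G A) :
    ∃ Q, IsHittingClique G A Q := by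
  by_cases hfree : P3Free G A
  · exact ⟨∅, empty_subset A, by simp, by simpa using hfree⟩
  · have hpocket : IsPocket G A ∅ A := ⟨subset_rfl, empty_subset A, by simp,
      disjoint_empty_right A, fun _ _ _ ha _ => .inl ha, hfree⟩
    exact hpocket.exists_isHittingClique hA

end HittingClique

section HittingCliqueWeights

open Finset

variable {V : Type*} {G : SimpleGraph V} {A K Q S U : Finset V} {o q z z' : V}

open Classical in
/-- The neighbors of `z` in `Q`. -/
noncomputable def nbrsIn (G : SimpleGraph V) (Q : Finset V) (z : V) : Finset V :=
  {q ∈ Q | G.Adj z q}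

theorem mem_nbrsIn : q ∈ nbrsIn G Q z ↔ q ∈ Q ∧ G.Adj z q := by
  simp [nbrsIn]

variable [DecidableEq V]

open Classical in
/-- The elements of `Q` that are not adjacent to `z`, but to all neighbors of `z` outside `Q` that
have more neighbors in `Q` than `z`. If `Q` is a hitting clique, then the component of `z` in
`A \ Q` is a clique whose vertices have nested neighborhoods in `Q`, and this is the difference
between the neighborhood of `z` and the next larger one. -/
noncomputable def nbrGap (G : SimpleGraph V) (A Q : Finset V) (z : V) : Finset V :=
  {q ∈ Q | ¬ G.Adj z q ∧
    ∀ z' ∈ A \ Q, G.Adj z z' → nbrsIn G Q z ⊆ nbrsIn G Q z' → G.Adj z' q}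

theorem mem_nbrGap : q ∈ nbrGap G A Q z ↔ q ∈ Q ∧ ¬ G.Adj z q ∧
    ∀ z' ∈ A \ Q, G.Adj z z' → nbrsIn G Q z ⊆ nbrsIn G Q z' → G.Adj z' q := by
  simp [nbrGap]

namespace IsHittingClique

theorem nbrsIn_subset_or_subset (h : IsHittingClique G A Q)
    (hC4 : ∀ a ∈ A, ∀ b ∈ A, ∀ c ∈ A, ∀ d ∈ A, ¬ IsC4 G a b c d) (hz : z ∈ A \ Q)
    (hz' : z' ∈ A \ Q) (hzz' : G.Adj z z') :
    nbrsIn G Q z ⊆ nbrsIn G Q z' ∨ nbrsIn G Q z' ⊆ nbrsIn G Q z := by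
  by_contra! ⟨hno, hno'⟩
  obtain ⟨q, hq, hq'⟩ := not_subset.1 hno
  obtain ⟨p, hp', hp⟩ := not_subset.1 hno'
  simp only [mem_nbrsIn, not_and] at hq hq' hp hp'
  replace hq' := hq' hq.1
  replace hp := hp hp'.1
  rw [mem_sdiff] at hz hz'
  have hqp : G.Adj q p := h.isClique hq.1 hp'.1 fun e => hq' (e ▸ hp'.2)
  have hne : ∀ {y t : V}, y ∉ Q → t ∈ Q → y ≠ t := fun hy ht e => hy (e ▸ ht)
  exact hC4 z hz.1 q (h.subset hq.1) p (h.subset hp'.1) z' hz'.1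
    ⟨⟨hq.2, hqp, hne hz.2 hp'.1, hp⟩, ⟨hqp, hp'.2.symm, (hne hz'.2 hq.1).symm, fun e => hq' e.symm⟩,
      ⟨hp'.2.symm, hzz'.symm, (hne hz.2 hp'.1).symm, fun e => hp e.symm⟩,
      hzz'.symm, hq.2, hne hz'.2 hq.1, hq'⟩

theorem card_nbrsIn_lt (h : IsHittingClique G A Q) (hA : TwinFree G A) (hz : z ∈ A \ Q)
    (hz' : z' ∈ A \ Q) (hzz' : G.Adj z z') (hsub : nbrsIn G Q z ⊆ nbrsIn G Q z') :
    #(nbrsIn G Q z) < #(nbrsIn G Q z') := by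
  refine card_lt_card (hsub.ssubset_of_ne fun heq => ?_)
  obtain ⟨a, ha, haz, haz', hsep⟩ := hA z (mem_sdiff.1 hz).1 z' (mem_sdiff.1 hz').1 hzz'
  refine hsep ?_
  by_cases haQ : a ∈ Q
  · simpa [mem_nbrsIn, haQ, G.adj_comm a] using Finset.ext_iff.1 heq a
  · have haQ := mem_sdiff.2 ⟨ha, haQ⟩
    exact ⟨fun hadj => h.p3Free_sdiff a haQ z hz z' hz' hadj hzz' haz',
      fun hadj => h.p3Free_sdiff a haQ z' hz' z hz hadj hzz'.symm haz⟩

theorem mem_nbrGap_of_card_le (h : IsHittingClique G A Q) (hA : TwinFree G A) (hz : z ∈ A \ Q)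
    (hq : q ∈ Q) (hzq : ¬ G.Adj z q)
    (hmax : ∀ z' ∈ A \ Q, ¬ G.Adj z' q → nbrsIn G Q z ⊆ nbrsIn G Q z' →
      #(nbrsIn G Q z') ≤ #(nbrsIn G Q z)) : q ∈ nbrGap G A Q z := by
  refine mem_nbrGap.2 ⟨hq, hzq, fun z' hz' hzz' hsub => by_contra fun hzq' => ?_⟩
  exact (hmax z' hz' hzq' hsub).not_gt
    (h.card_nbrsIn_lt hA hz hz' hzz' hsub)

theorem exists_not_adj_of_maximal (h : Maximal (IsHittingClique G A) Q) (hz : z ∈ A \ Q) :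
    ∃ q ∈ Q, ¬ G.Adj z q := by
  by_contra! hadj
  obtain ⟨hzA, hzQ⟩ := mem_sdiff.1 hz
  refine hzQ (h.le_of_ge ⟨insert_subset hzA h.prop.subset, ?_, ?_⟩ (subset_insert z Q)
    (mem_insert_self z Q))
  · rw [coe_insert]
    exact h.prop.isClique.insert fun q hq _ => hadj q hq
  · exact h.prop.p3Free_sdiff.mono (sdiff_subset_sdiff subset_rfl (subset_insert z Q))

theorem nbrGap_nonempty (h : Maximal (IsHittingClique G A) Q) (hA : TwinFree G A)
    (hC4 : ∀ a ∈ A, ∀ b ∈ A, ∀ c ∈ A, ∀ d ∈ A, ¬ IsC4 G a b c d) (hz : z ∈ A \ Q) :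
    (nbrGap G A Q z).Nonempty := by
  classical
  let T := {z' ∈ A \ Q | G.Adj z z' ∧ nbrsIn G Q z ⊆ nbrsIn G Q z'}
  obtain hT | hT := T.eq_empty_or_nonempty
  · obtain ⟨q, hq, hzq⟩ := exists_not_adj_of_maximal h hz
    refine ⟨q, mem_nbrGap.2 ⟨hq, hzq, fun z' hz' hzz' hsub => ?_⟩⟩
    exact absurd ⟨hzz', hsub⟩ (filter_eq_empty_iff.1 hT hz')
  obtain ⟨z', hz', hmin⟩ := exists_min_image T (fun z' => #(nbrsIn G Q z')) hT
  obtain ⟨hz', hzz', hsub⟩ := mem_filter.1 hz'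
  obtain ⟨q, hq, hzq⟩ := exists_mem_notMem_of_card_lt_card
    (h.prop.card_nbrsIn_lt hA hz hz' hzz' hsub)
  have hqQ := (mem_nbrsIn.1 hq).1
  refine ⟨q, mem_nbrGap.2 ⟨hqQ, fun hadj => hzq (mem_nbrsIn.2 ⟨hqQ, hadj⟩),
    fun y hy hzy hsuby => ?_⟩⟩
  suffices hle : nbrsIn G Q z' ⊆ nbrsIn G Q y from (mem_nbrsIn.1 (hle hq)).2
  by_cases hyz' : z' = y
  · rw [hyz']
  have hadj : G.Adj z' y := h.prop.p3Free_sdiff z' hz' z hz y hy hzz'.symm hzy hyz'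
  refine (h.prop.nbrsIn_subset_or_subset hC4 hz' hy hadj).resolve_right fun hle => ?_
  exact (hmin y (mem_filter.2 ⟨hy, hzy, hsuby⟩)).not_gt
    (h.prop.card_nbrsIn_lt hA hy hz' hadj.symm hle)

theorem disjoint_nbrGap (h : IsHittingClique G A Q)
    (hC4 : ∀ a ∈ A, ∀ b ∈ A, ∀ c ∈ A, ∀ d ∈ A, ¬ IsC4 G a b c d) (hz : z ∈ A \ Q)
    (hz' : z' ∈ A \ Q) (hzz' : G.Adj z z') : Disjoint (nbrGap G A Q z) (nbrGap G A Q z') := by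
  refine Finset.disjoint_left.2 fun q hq hq' => ?_
  obtain ⟨-, hzq, hlarger⟩ := mem_nbrGap.1 hq
  obtain ⟨-, hzq', hlarger'⟩ := mem_nbrGap.1 hq'
  obtain hsub | hsub := h.nbrsIn_subset_or_subset hC4 hz hz' hzz'
  · exact hzq' (hlarger z' hz' hzz' hsub)
  · exact hzq (hlarger' z hz hzz'.symm hsub)

theorem exists_splits (h : IsHittingClique G A Q) (hA : TwinFree G A) (hKQ : K ⊆ Q)
    (hK : 1 < #K) : ∃ z ∈ A \ Q, Splits G.Adj z K := by
  obtain ⟨u, hu, v, hv, huv⟩ := one_lt_card.1 hK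
  have huQ := hKQ hu
  have hvQ := hKQ hv
  obtain ⟨z, hz, hzu, hzv, hsep⟩ :=
    hA u (h.subset huQ) v (h.subset hvQ) (h.isClique huQ hvQ huv)
  refine ⟨z, mem_sdiff.2 ⟨hz, fun hzQ => hsep ?_⟩, ?_⟩
  · exact iff_of_true (h.isClique hzQ huQ hzu) (h.isClique hzQ hvQ hzv)
  · by_cases hadj : G.Adj z u
    · exact ⟨⟨u, hu, hadj⟩, v, hv, fun hadj' => hsep (iff_of_true hadj hadj')⟩
    · exact ⟨⟨v, hv, by_contra fun hadj' => hsep (iff_of_false hadj hadj')⟩, u, hu, hadj⟩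

theorem exists_forall_ne_exists_splits (h : IsHittingClique G A Q) (hA : TwinFree G A)
    (hKQ : K ⊆ Q) (hK : K.Nonempty) :
    ∃ p ∈ K, ∀ q ∈ K, q ≠ p → ∃ z ∈ A \ Q, Splits G.Adj z K ∧ q ∈ nbrGap G A Q z := by
  classical
  induction K using Finset.strongInduction with
  | H K ih =>
    obtain hcard | hcard := (Nat.one_le_iff_ne_zero.2 hK.card_pos.ne').eq_or_lt
    · obtain ⟨p, rfl⟩ := card_eq_one.1 hcard.symm
      exact ⟨p, mem_singleton_self p, fun q hq hqp => absurd (mem_singleton.1 hq) hqp⟩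
    obtain ⟨y, hy, hyK⟩ := h.exists_splits hA hKQ hcard
    obtain ⟨z, hz, hmax⟩ := exists_max_image {z ∈ A \ Q | Splits G.Adj z K}
      (fun z => #(nbrsIn G Q z)) ⟨y, mem_filter.2 ⟨hy, hyK⟩⟩
    obtain ⟨hz, ⟨a, ha, hza⟩, b, hb, hzb⟩ := mem_filter.1 hz
    have hsub : {q ∈ K | G.Adj z q} ⊆ K := filter_subset _ K
    obtain ⟨p, hp, hcover⟩ := ih {q ∈ K | G.Adj z q} (filter_ssubset.2 ⟨b, hb, hzb⟩)
      (hsub.trans hKQ) ⟨a, mem_filter.2 ⟨ha, hza⟩⟩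
    refine ⟨p, hsub hp, fun q hq hqp => ?_⟩
    by_cases hzq : G.Adj z q
    · obtain ⟨t, ht, htK, hqt⟩ := hcover q (mem_filter.2 ⟨hq, hzq⟩) hqp
      exact ⟨t, ht, htK.mono hsub, hqt⟩
    · refine ⟨z, hz, ⟨⟨a, ha, hza⟩, b, hb, hzb⟩, h.mem_nbrGap_of_card_le hA hz (hKQ hq) hzq
        fun t ht htq hle => hmax t (mem_filter.2 ⟨ht, ⟨a, ha, ?_⟩, q, hq, htq⟩)⟩
      exact (mem_nbrsIn.1 (hle (mem_nbrsIn.2 ⟨hKQ ha, hza⟩))).2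

end IsHittingClique

open Classical in
/-- The weight one on a hitting clique `Q` of `A`, and the size of the neighborhood gap on the
other vertices. -/
noncomputable def gapWeight (G : SimpleGraph V) (A Q : Finset V) (v : V) : ℕ :=
  if v ∈ Q then 1 else #(nbrGap G A Q v)

theorem sum_gapWeight (S : Finset V) :
    ∑ v ∈ S, gapWeight G A Q v = #(S ∩ Q) + ∑ v ∈ S \ Q, #(nbrGap G A Q v) := by
  rw [← sum_inter_add_sum_sdiff S Q, card_eq_sum_ones]
  congr 1
  · exact sum_congr rfl fun v hv => if_pos (mem_inter.1 hv).2
  · exact sum_congr rfl fun v hv => if_neg (mem_sdiff.1 hv).2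

namespace IsHittingClique

theorem one_le_gapWeight (h : Maximal (IsHittingClique G A) Q) (hA : TwinFree G A)
    (hC4 : ∀ a ∈ A, ∀ b ∈ A, ∀ c ∈ A, ∀ d ∈ A, ¬ IsC4 G a b c d) {v : V} (hv : v ∈ A) :
    1 ≤ gapWeight G A Q v := by
  unfold gapWeight
  split_ifs with hvQ
  · exact le_rfl
  · exact card_pos.2 (nbrGap_nonempty h hA hC4 (mem_sdiff.2 ⟨hv, hvQ⟩))

theorem sum_gapWeight_le_of_isClique (h : IsHittingClique G A Q)
    (hC4 : ∀ a ∈ A, ∀ b ∈ A, ∀ c ∈ A, ∀ d ∈ A, ¬ IsC4 G a b c d) (hKA : K ⊆ A)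
    (hK : G.IsClique K) : ∑ v ∈ K, gapWeight G A Q v ≤ #Q := by
  have hKQ : K \ Q ⊆ A \ Q := sdiff_subset_sdiff hKA subset_rfl
  have hpair : ((K \ Q : Finset V) : Set V).PairwiseDisjoint (nbrGap G A Q) := by
    intro z hz z' hz' hne
    refine h.disjoint_nbrGap hC4 (hKQ hz) (hKQ hz') (hK ?_ ?_ hne)
    · exact (mem_sdiff.1 hz).1
    · exact (mem_sdiff.1 hz').1
  have hdisj : Disjoint (K ∩ Q) ((K \ Q).biUnion (nbrGap G A Q)) := by
    refine (disjoint_biUnion_right _ _ _).2 fun z hz => Finset.disjoint_left.2 fun q hq hqz => ?_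
    obtain ⟨hzK, hzQ⟩ := mem_sdiff.1 hz
    obtain ⟨hqK, hqQ⟩ := mem_inter.1 hq
    exact (mem_nbrGap.1 hqz).2.1 (hK hzK hqK fun e => hzQ (e ▸ hqQ))
  rw [sum_gapWeight, ← card_biUnion hpair, ← card_union_of_disjoint hdisj]
  exact card_le_card (union_subset inter_subset_right
    (biUnion_subset.2 fun z _ q hq => (mem_nbrGap.1 hq).1))

/-- A vertex of `S` outside `Q` does not split `S ∩ Q`, so the gaps that cover `S ∩ Q` up to one
vertex belong to vertices outside `S`. -/
theorem card_inter_le_sum_card_nbrGap (h : IsHittingClique G A Q) (hA : TwinFree G A)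
    (hS : P3Free G S) : #(S ∩ Q) ≤ ∑ z ∈ (A \ S) \ Q, #(nbrGap G A Q z) + 1 := by
  obtain hempty | hne := (S ∩ Q).eq_empty_or_nonempty
  · simp [hempty]
  obtain ⟨p, hp, hcover⟩ := h.exists_forall_ne_exists_splits hA inter_subset_right hne
  rw [← card_erase_add_one hp]
  gcongr 1
  refine (card_le_card fun q hq => ?_).trans card_biUnion_le
  obtain ⟨hqp, hq⟩ := mem_erase.1 hq
  obtain ⟨z, hz, ⟨⟨u, hu, hzu⟩, v, hv, hzv⟩, hqz⟩ := hcover q hq hqp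
  rw [mem_sdiff] at hz
  rw [mem_inter] at hu hv
  refine mem_biUnion.2 ⟨z, mem_sdiff.2 ⟨mem_sdiff.2 ⟨hz.1, fun hzS => hzv ?_⟩, hz.2⟩, hqz⟩
  have huv : G.Adj u v := h.isClique hu.2 hv.2 fun e => hzv (e ▸ hzu)
  exact hS z hzS u hu.1 v hv.1 hzu huv fun e => hz.2 (e ▸ hv.2)

theorem sum_gapWeight_add_card_le_of_p3Free (h : IsHittingClique G A Q) (hA : TwinFree G A)
    (hSA : S ⊆ A) (hS : P3Free G S) :
    ∑ v ∈ S, gapWeight G A Q v + #Q ≤ ∑ v ∈ A, gapWeight G A Q v + 1 := by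
  have hsplit := sum_sdiff (f := gapWeight G A Q) hSA
  rw [sum_gapWeight (A \ S)] at hsplit
  have hgap := h.card_inter_le_sum_card_nbrGap hA hS
  have hcard : #((A \ S) ∩ Q) + #(S ∩ Q) = #Q := by
    rw [← card_union_of_disjoint (sdiff_disjoint.mono inter_subset_left inter_subset_left),
      ← union_inter_distrib_right, sdiff_union_of_subset hSA, inter_eq_right.2 h.subset]
  omega

theorem two_mul_card_le_sum_gapWeight (h : IsHittingClique G A Q) (hA : TwinFree G A)
    (huniv : ∀ u ∈ A, ∃ z ∈ A, z ≠ u ∧ ¬ G.Adj z u) :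
    2 * #Q ≤ ∑ v ∈ A, gapWeight G A Q v := by
  classical
  have hcover : Q ⊆ (A \ Q).biUnion (nbrGap G A Q) := by
    intro q hq
    obtain ⟨y, hy, hyq, hn⟩ := huniv q (h.subset hq)
    have hyQ : y ∉ Q := fun hyQ => hn (h.isClique hyQ hq hyq)
    obtain ⟨z, hz, hmax⟩ := exists_max_image {z ∈ A \ Q | ¬ G.Adj z q}
      (fun z => #(nbrsIn G Q z)) ⟨y, mem_filter.2 ⟨mem_sdiff.2 ⟨hy, hyQ⟩, hn⟩⟩
    obtain ⟨hz, hzq⟩ := mem_filter.1 hz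
    exact mem_biUnion.2 ⟨z, hz, h.mem_nbrGap_of_card_le hA hz hq hzq
      fun t ht htq _ => hmax t (mem_filter.2 ⟨ht, htq⟩)⟩
  have hcard := (card_le_card hcover).trans card_biUnion_le
  rw [sum_gapWeight, inter_eq_right.2 h.subset]
  omega

end IsHittingClique

theorem TwinFree.erase (hU : TwinFree G U) (hadj : ∀ v ∈ U.erase o, G.Adj o v) :
    TwinFree G (U.erase o) := by
  intro u hu v hv huv
  obtain ⟨z, hz, hzu, hzv, hsep⟩ := hU u (mem_of_mem_erase hu) v (mem_of_mem_erase hv) huv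
  refine ⟨z, mem_erase.2 ⟨?_, hz⟩, hzu, hzv, hsep⟩
  rintro rfl
  exact hsep (iff_of_true (hadj u hu) (hadj v hv))

theorem TwinFree.exists_not_adj (hU : TwinFree G U) (ho : o ∈ U)
    (hadj : ∀ v ∈ U.erase o, G.Adj o v) {u : V} (hu : u ∈ U.erase o) :
    ∃ z ∈ U.erase o, z ≠ u ∧ ¬ G.Adj z u := by
  obtain ⟨z, hz, hzo, hzu, hsep⟩ := hU o ho u (mem_of_mem_erase hu) (hadj u hu)
  have hz : z ∈ U.erase o := mem_erase.2 ⟨hzo, hz⟩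
  exact ⟨z, hz, hzu, fun hn => hsep (iff_of_true (hadj z hz).symm hn)⟩

theorem PatternFree.exists_maximal_isHittingClique (hA : PatternFree G A) :
    ∃ Q, Maximal (IsHittingClique G A) Q :=
  (A.powerset.finite_toSet.subset fun _ hQ => mem_powerset.2 hQ.subset).exists_maximal
    hA.exists_isHittingClique

theorem TwinFree.exists_weight_two_mul_sum_le (hU : TwinFree G U) (ho : o ∈ U)
    (hadj : ∀ v ∈ U.erase o, G.Adj o v) (hA : PatternFree G (U.erase o)) :
    ∃ c : V → ℕ, (∀ v ∈ U, 1 ≤ c v) ∧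
      ∀ S ⊆ U, P3Free G S → 2 * ∑ v ∈ S, c v ≤ ∑ v ∈ U, c v + 1 := by
  obtain ⟨Q, hQ⟩ := hA.exists_maximal_isHittingClique
  have htwin := hU.erase hadj
  have htotal := hQ.prop.two_mul_card_le_sum_gapWeight htwin
    fun u hu => hU.exists_not_adj ho hadj hu
  let W := ∑ v ∈ U.erase o, gapWeight G (U.erase o) Q v
  let c := Function.update (gapWeight G (U.erase o) Q) o (W + 1 - 2 * #Q)
  have hco : c o = W + 1 - 2 * #Q := Function.update_self ..
  have hsum : ∀ S : Finset V, o ∉ S → ∑ v ∈ S, c v = ∑ v ∈ S, gapWeight G (U.erase o) Q v :=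
    fun S hoS => sum_update_of_notMem hoS _ _
  refine ⟨c, fun v hv => ?_, fun S hSU hS => ?_⟩
  · by_cases hvo : v = o
    · rw [hvo, hco]
      omega
    · refine (?_ : 1 ≤ gapWeight G _ Q v).trans_eq (Function.update_of_ne hvo ..).symm
      exact IsHittingClique.one_le_gapWeight hQ htwin hA.not_isC4 (mem_erase.2 ⟨hvo, hv⟩)
  · rw [← add_sum_erase U c ho, hsum _ (notMem_erase o U), hco]
    by_cases hoS : o ∈ S
    · have hSU : S.erase o ⊆ U.erase o := erase_subset_erase o hSU
      have hK : G.IsClique (S.erase o : Finset V) := fun u hu v hv =>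
        hS u (mem_of_mem_erase hu) o hoS v (mem_of_mem_erase hv) (hadj u (hSU hu)).symm
          (hadj v (hSU hv))
      have hclique := hQ.prop.sum_gapWeight_le_of_isClique hA.not_isC4 hSU hK
      rw [← add_sum_erase S c hoS, hsum _ (notMem_erase o S), hco]
      omega
    · have hSU : S ⊆ U.erase o := subset_erase.2 ⟨hSU, hoS⟩
      have hfree := hQ.prop.sum_gapWeight_add_card_le_of_p3Free htwin hSU hS
      rw [hsum S hoS]
      omega

end HittingCliqueWeights

section TwinClasses

open Finset

variable {V : Type*} {G : SimpleGraph V} {F R S : Finset V} {u u' v v' z : V}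

open Classical in
/-- The closed neighborhood of `v` in `F`. -/
noncomputable def closedNbrsIn (G : SimpleGraph V) (F : Finset V) (v : V) : Finset V :=
  {z ∈ F | z = v ∨ G.Adj v z}

theorem mem_closedNbrsIn : z ∈ closedNbrsIn G F v ↔ z ∈ F ∧ (z = v ∨ G.Adj v z) := by
  simp [closedNbrsIn]

theorem closedNbrsIn_subset : closedNbrsIn G F v ⊆ F :=
  fun _ hz => (mem_closedNbrsIn.1 hz).1

theorem self_mem_closedNbrsIn (hv : v ∈ F) : v ∈ closedNbrsIn G F v :=
  mem_closedNbrsIn.2 ⟨hv, .inl rfl⟩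

theorem adj_of_mem_closedNbrsIn (hz : z ∈ closedNbrsIn G F v) (hne : z ≠ v) : G.Adj v z :=
  (mem_closedNbrsIn.1 hz).2.resolve_left hne

theorem mem_closedNbrsIn_comm (hu : u ∈ F) (hv : v ∈ F) :
    u ∈ closedNbrsIn G F v ↔ v ∈ closedNbrsIn G F u := by
  simp only [mem_closedNbrsIn, hu, hv, true_and, eq_comm, G.adj_comm]

theorem adj_iff_mem_closedNbrsIn (hv : v ∈ F) (hne : u ≠ v) :
    G.Adj u v ↔ v ∈ closedNbrsIn G F u := by
  simp [mem_closedNbrsIn, hv, hne.symm]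

theorem adj_iff_adj_of_closedNbrsIn_eq (hu' : u' ∈ F) (hv : v ∈ F) (hv' : v' ∈ F)
    (hu : closedNbrsIn G F u = closedNbrsIn G F u') (h : closedNbrsIn G F v = closedNbrsIn G F v')
    (hne : u ≠ v) (hne' : u' ≠ v') : G.Adj u v ↔ G.Adj u' v' := by
  rw [adj_iff_mem_closedNbrsIn hv hne, adj_iff_mem_closedNbrsIn hv' hne', hu,
    mem_closedNbrsIn_comm hv hu', h, mem_closedNbrsIn_comm hu' hv']

open Classical in
/-- The vertices of `F` that have the same closed neighborhood in `F` as `v`. -/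
noncomputable def twinClass (G : SimpleGraph V) (F : Finset V) (v : V) : Finset V :=
  {u ∈ F | closedNbrsIn G F u = closedNbrsIn G F v}

theorem mem_twinClass :
    u ∈ twinClass G F v ↔ u ∈ F ∧ closedNbrsIn G F u = closedNbrsIn G F v := by
  simp [twinClass]

theorem twinClass_subset : twinClass G F v ⊆ F :=
  fun _ hu => (mem_twinClass.1 hu).1

theorem self_mem_twinClass (hv : v ∈ F) : v ∈ twinClass G F v :=
  mem_twinClass.2 ⟨hv, rfl⟩

theorem isClique_twinClass : G.IsClique (twinClass G F v) := by
  intro a ha b hb hab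
  obtain ⟨-, ha⟩ := mem_twinClass.1 ha
  obtain ⟨hbF, hb⟩ := mem_twinClass.1 hb
  rw [adj_iff_mem_closedNbrsIn hbF hab, ha, ← hb]
  exact self_mem_closedNbrsIn hbF

/-- `R` contains exactly one element of each twin class of `F`. -/
structure IsTwinTransversal (G : SimpleGraph V) (F R : Finset V) : Prop where
  subset : R ⊆ F
  injOn : Set.InjOn (closedNbrsIn G F) R
  exists_closedNbrsIn_eq : ∀ v ∈ F, ∃ p ∈ R, closedNbrsIn G F p = closedNbrsIn G F v

theorem exists_isTwinTransversal (G : SimpleGraph V) (F : Finset V) :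
    ∃ R, IsTwinTransversal G F R := by
  classical
  obtain ⟨R, hRF, hinj, himage⟩ := exists_subset_injOn_image_eq_of_surjOn (f := closedNbrsIn G F)
    (F : Set V) (F.image (closedNbrsIn G F)) (by simpa using Set.surjOn_image _ _)
  refine ⟨R, coe_subset.1 hRF, hinj, fun v hv => ?_⟩
  rw [← mem_image, himage]
  exact mem_image_of_mem _ hv

namespace IsTwinTransversal

theorem exists_separating_of_mem_of_notMem (h : IsTwinTransversal G F R) (hu : u ∈ R)
    (hv : v ∈ R) (huv : G.Adj u v) (hzu : z ∈ closedNbrsIn G F u) (hzv : z ∉ closedNbrsIn G F v) :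
    ∃ p ∈ R, p ≠ u ∧ p ≠ v ∧ G.Adj p u ∧ ¬ G.Adj p v := by
  have hz := closedNbrsIn_subset hzu
  obtain ⟨p, hp, hpz⟩ := h.exists_closedNbrsIn_eq z hz
  rw [mem_closedNbrsIn_comm hz (h.subset hu), ← hpz] at hzu
  rw [mem_closedNbrsIn_comm hz (h.subset hv), ← hpz] at hzv
  have hpu : u ≠ p := by
    rintro rfl
    exact hzv (mem_closedNbrsIn.2 ⟨h.subset hv, .inr huv⟩)
  refine ⟨p, hp, hpu.symm, ?_, adj_of_mem_closedNbrsIn hzu hpu, fun hpv => ?_⟩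
  · rintro rfl
    exact hzv (self_mem_closedNbrsIn (h.subset hv))
  · exact hzv (mem_closedNbrsIn.2 ⟨h.subset hv, .inr hpv⟩)

theorem twinFree (h : IsTwinTransversal G F R) : TwinFree G R := by
  intro u hu v hv huv
  have hne : closedNbrsIn G F u ≠ closedNbrsIn G F v := fun e => huv.ne (h.injOn hu hv e)
  obtain hnot | hnot := not_and_or.1 fun hsub => hne (subset_antisymm hsub.1 hsub.2)
  · obtain ⟨z, hzu, hzv⟩ := not_subset.1 hnot
    obtain ⟨p, hp, hpu, hpv, hadj, hnadj⟩ :=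
      h.exists_separating_of_mem_of_notMem hu hv huv hzu hzv
    exact ⟨p, hp, hpu, hpv, fun hiff => hnadj (hiff.1 hadj)⟩
  · obtain ⟨z, hzv, hzu⟩ := not_subset.1 hnot
    obtain ⟨p, hp, hpv, hpu, hadj, hnadj⟩ :=
      h.exists_separating_of_mem_of_notMem hv hu huv.symm hzv hzu
    exact ⟨p, hp, hpu, hpv, fun hiff => hnadj (hiff.2 hadj)⟩

theorem pairwiseDisjoint_twinClass (h : IsTwinTransversal G F R) :
    (R : Set V).PairwiseDisjoint (twinClass G F) := by
  intro p hp q hq hpq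
  refine Finset.disjoint_left.2 fun v hv hv' => hpq (h.injOn hp hq ?_)
  exact (mem_twinClass.1 hv).2.symm.trans (mem_twinClass.1 hv').2

theorem biUnion_twinClass [DecidableEq V] (h : IsTwinTransversal G F R) :
    R.biUnion (twinClass G F) = F := by
  refine subset_antisymm (biUnion_subset.2 fun _ _ => twinClass_subset) fun v hv => ?_
  obtain ⟨p, hp, hpv⟩ := h.exists_closedNbrsIn_eq v hv
  exact mem_biUnion.2 ⟨p, hp, mem_twinClass.2 ⟨hv, hpv.symm⟩⟩

theorem sum_card_twinClass (h : IsTwinTransversal G F R) : ∑ p ∈ R, #(twinClass G F p) = #F := by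
  classical
  rw [← card_biUnion h.pairwiseDisjoint_twinClass, h.biUnion_twinClass]

theorem p3Free_of_forall_not_disjoint {T : Finset V} (h : IsTwinTransversal G F R) (hTR : T ⊆ R)
    (hS : P3Free G S) (hT : ∀ p ∈ T, ¬ Disjoint S (twinClass G F p)) : P3Free G T := by
  have hrep : ∀ p ∈ T, ∃ v ∈ S, v ∈ F ∧ closedNbrsIn G F v = closedNbrsIn G F p := fun p hp => by
    obtain ⟨v, hvS, hv⟩ := Finset.not_disjoint_iff.1 (hT p hp)
    exact ⟨v, hvS, mem_twinClass.1 hv⟩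
  choose! f hfS hfF hf using hrep
  have hne : ∀ p ∈ T, ∀ q ∈ T, p ≠ q → f p ≠ f q := fun p hp q hq hpq e =>
    hpq (h.injOn (hTR hp) (hTR hq) ((hf p hp).symm.trans ((congr_arg _ e).trans (hf q hq))))
  have hadj : ∀ p ∈ T, ∀ q ∈ T, p ≠ q → (G.Adj (f p) (f q) ↔ G.Adj p q) := fun p hp q hq hpq =>
    adj_iff_adj_of_closedNbrsIn_eq (h.subset (hTR hp)) (hfF q hq) (h.subset (hTR hq)) (hf p hp)
      (hf q hq) (hne p hp q hq hpq) hpq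
  intro a ha b hb d hd hab hbd had
  refine (hadj a ha d hd had).1 (hS _ (hfS a ha) _ (hfS b hb) _ (hfS d hd) ?_ ?_
    (hne a ha d hd had))
  · exact (hadj a ha b hb hab.ne).2 hab
  · exact (hadj b hb d hd hbd.ne).2 hbd

end IsTwinTransversal

end TwinClasses

section Blowup

open Finset

variable {V : Type*} {G : SimpleGraph V} {C F R U Z : Finset V} {v : V} {m : ℕ} {w : V → ℕ}

/-- Weights on `U` that let the clique `C` act like a single vertex of weight `m`: up to the
constant `#C - 1`, which is half of the remaining weight, an induced cluster graph weighs at most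
`m` if it meets `C`, and nothing otherwise. -/
structure IsBlowupWeight (G : SimpleGraph V) (U C : Finset V) (m : ℕ) (c : V → ℕ) : Prop where
  one_le : ∀ v ∈ C, 1 ≤ c v
  exists_support : ∃ H ⊆ U, #H ≤ 2 * #C ∧ ∀ v ∈ U, v ∉ H → c v = 0
  sum_add_two : ∑ v ∈ U, c v + 2 = 2 * #C + m
  sum_add_one_le : ∀ S, P3Free G S → ∑ v ∈ S, c v + 1 ≤ #C + m
  sum_add_one_le_of_disjoint : ∀ S, Disjoint S C → ∑ v ∈ S, c v + 1 ≤ #C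

theorem IsSeparatingWeight.exists_card_le_sum (h : IsSeparatingWeight G.Adj Z C w) :
    ∃ H ⊆ Z, #H ≤ #C ∧ ∀ v ∉ H, w v = 0 := by
  refine ⟨{v ∈ Z | w v ≠ 0}, filter_subset _ Z, ?_, fun v hv => ?_⟩
  · have hcard : #{v ∈ Z | w v ≠ 0} ≤ ∑ v ∈ Z with w v ≠ 0, w v := by
      simpa using card_nsmul_le_sum _ w 1 fun v hv => Nat.one_le_iff_ne_zero.2 (mem_filter.1 hv).2
    have := h.sum_add_one_le {v ∈ Z | w v ≠ 0}
    omega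
  · by_contra hwv
    exact hv (mem_filter.2 ⟨by_contra fun hvZ => hwv (h.eq_zero_of_notMem v hvZ), hwv⟩)

theorem IsSeparatingWeight.exists_isBlowupWeight [DecidableEq V]
    (h : IsSeparatingWeight G.Adj (U \ C) C w) (hCU : C ⊆ U) (hC : G.IsClique C) (hv : v ∈ C)
    (hm : 1 ≤ m) : ∃ c, IsBlowupWeight G U C m c := by
  let c : V → ℕ := fun z => (if z ∈ C then 1 else 0) + (Pi.single v (m - 1) : V → ℕ) z + w z
  have hsum : ∀ S : Finset V,
      ∑ z ∈ S, c z = #(S ∩ C) + (if v ∈ S then m - 1 else 0) + ∑ z ∈ S, w z := by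
    simp [c, sum_add_distrib]
  refine ⟨c, fun z hz => ?_, ?_, ?_, fun S hS => ?_, fun S hdisj => ?_⟩
  · simp only [c, if_pos hz]
    omega
  · obtain ⟨H, hHU, hH, hw⟩ := h.exists_card_le_sum
    refine ⟨C ∪ H, union_subset hCU (hHU.trans sdiff_subset), ?_, fun z _ hz => ?_⟩
    · have := card_union_le C H
      omega
    · rw [mem_union, not_or] at hz
      simp [c, hz.1, hw z hz.2, (ne_of_mem_of_not_mem hv hz.1).symm]
  · have hwU : ∑ z ∈ U, w z = ∑ z ∈ U \ C, w z :=
      (sum_subset sdiff_subset fun z _ hz => h.eq_zero_of_notMem z hz).symm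
    have := h.sum_add_one
    rw [hsum, inter_eq_right.2 hCU, if_pos (hCU hv), hwU]
    omega
  · have := h.card_inter_add_sum_le hC sdiff_disjoint hS
    rw [hsum]
    split_ifs <;> omega
  · have := h.sum_add_one_le S
    rw [hsum, disjoint_iff_inter_eq_empty.1 hdisj, card_empty,
      if_neg fun hvS => Finset.disjoint_left.1 hdisj hvS hv]
    omega

theorem TwinFree.exists_isBlowupWeight_twinClass (hU : TwinFree G U) (hFU : F ⊆ U) (hv : v ∈ F)
    (hm : 1 ≤ m) : ∃ c, IsBlowupWeight G U (twinClass G F v) m c := by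
  classical
  have hCU : twinClass G F v ⊆ U := twinClass_subset.trans hFU
  obtain ⟨w, hw⟩ := hU.exists_isSeparatingWeight hCU isClique_twinClass
    ⟨v, self_mem_twinClass hv⟩
  exact hw.exists_isBlowupWeight hCU isClique_twinClass (self_mem_twinClass hv) hm

theorem IsTwinTransversal.exists_weight_two_mul_sum_le {b : V → ℕ} (h : IsTwinTransversal G F R)
    (hU : TwinFree G U) (hFU : F ⊆ U) (hb : ∀ v ∈ R, 1 ≤ b v)
    (hhalf : ∀ T ⊆ R, P3Free G T → 2 * ∑ v ∈ T, b v ≤ ∑ v ∈ R, b v + 1) :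
    ∃ c : V → ℕ, (∀ v ∈ F, 1 ≤ c v) ∧
      (∃ H ⊆ U, #H ≤ 2 * #F ∧ ∀ v ∈ U, v ∉ H → c v = 0) ∧
      ∀ S, P3Free G S → 2 * ∑ v ∈ S, c v ≤ ∑ v ∈ U, c v + 1 := by
  classical
  choose! w hw using fun p (hp : p ∈ R) =>
    hU.exists_isBlowupWeight_twinClass hFU (h.subset hp) (hb p hp)
  choose! H hHU hHcard hHw using fun p hp => (hw p hp).exists_support
  refine ⟨fun v => ∑ p ∈ R, w p v, fun v hv => ?_, ⟨R.biUnion H, ?_, ?_, ?_⟩, fun S hS => ?_⟩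
  · rw [← h.biUnion_twinClass] at hv
    obtain ⟨p, hp, hvp⟩ := mem_biUnion.1 hv
    exact ((hw p hp).one_le v hvp).trans
      (single_le_sum (f := (w · v)) (fun _ _ => Nat.zero_le _) hp)
  · exact biUnion_subset.2 hHU
  · rw [← h.sum_card_twinClass, mul_sum]
    exact card_biUnion_le.trans (sum_le_sum hHcard)
  · exact fun v hv hvH => sum_eq_zero fun p hp =>
      hHw p hp v hv fun hvp => hvH (mem_biUnion.2 ⟨p, hp, hvp⟩)
  · have hT := hhalf {p ∈ R | ¬ Disjoint S (twinClass G F p)} (filter_subset _ R)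
      (h.p3Free_of_forall_not_disjoint (filter_subset _ R) hS fun p hp => (mem_filter.1 hp).2)
    have hle : ∑ p ∈ R, (∑ v ∈ S, w p v + 1) ≤
        ∑ p ∈ R, (#(twinClass G F p) + if ¬ Disjoint S (twinClass G F p) then b p else 0) := by
      refine sum_le_sum fun p hp => ?_
      split_ifs with hdisj
      · exact (hw p hp).sum_add_one_le_of_disjoint S hdisj
      · exact (hw p hp).sum_add_one_le S hS
    have htotal : ∑ p ∈ R, (∑ v ∈ U, w p v + 2) = ∑ p ∈ R, (2 * #(twinClass G F p) + b p) :=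
      sum_congr rfl fun p hp => (hw p hp).sum_add_two
    simp only [sum_add_distrib, ← mul_sum, sum_const, smul_eq_mul, ← sum_filter] at hle htotal
    rw [sum_comm, sum_comm (s := U)]
    omega

end Blowup

section LocalRatioWeights

open Finset

variable {V : Type*} {G : SimpleGraph V} {A U : Finset V} {o : V} {r k : ℕ} {α : ℝ} {x : V → ℝ}

theorem two_le_of_one_le_sub_two_mul (hk : 1 ≤ (α - 2) * k) : 2 ≤ α :=
  sub_nonneg.1 (pos_of_mul_pos_left (one_pos.trans_le hk) k.cast_nonneg).le

namespace HasHeavyClusters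

theorem patternFree (hU : HasHeavyClusters G U r α) (hα : 2 ≤ α) (hr : 8 ≤ r) (ho : o ∈ U)
    (hA : ∀ v ∈ A, v ∈ U ∧ G.Adj o v) : PatternFree G A where
  not_isC4 a ha b hb c hc d hd :=
    hU.not_isC4 hα (by omega) (hA a ha).1 (hA b hb).1 (hA c hc).1 (hA d hd).1
  not_isC5 a ha b hb c hc d hd e he := hU.not_isC5 hα (by omega) ho (by simp [*])
  not_isP3Pair a₁ ha₁ a₂ ha₂ a₃ ha₃ b₁ hb₁ b₂ hb₂ b₃ hb₃ :=
    hU.not_isP3Pair hα hr ho (by simp [*])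

theorem card_closedNbrsIn_le (hU : HasHeavyClusters G U r α) (htwin : TwinFree G U)
    (hk : 1 ≤ (α - 2) * k) (hr : 2 * (k ^ 3 + 4) ≤ r) (ho : o ∈ U) :
    #(closedNbrsIn G U o) ≤ k ^ 3 + 1 := by
  classical
  have hα : 2 ≤ α := two_le_of_one_le_sub_two_mul hk
  have hkr : 2 * k + 1 ≤ r := by
    have := Nat.le_self_pow three_ne_zero k
    omega
  have hA : ∀ v ∈ (closedNbrsIn G U o).erase o, v ∈ U ∧ G.Adj o v := fun v hv =>
    ⟨closedNbrsIn_subset (mem_of_mem_erase hv),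
      adj_of_mem_closedNbrsIn (mem_of_mem_erase hv) (ne_of_mem_erase hv)⟩
  have hAU : (closedNbrsIn G U o).erase o ⊆ U := fun v hv => (hA v hv).1
  rw [← card_erase_add_one (self_mem_closedNbrsIn ho), pow_succ]
  gcongr 1
  exact card_le_of_forall_not_isC4
    (fun K hKA hK => hU.card_le_of_isClique htwin hk hkr (hKA.trans hAU) hK)
    (fun I hIA hI => hU.card_le_of_isIndepSet hk hkr ho (hIA.trans hAU)
      (fun v hv => (hA v (hIA hv)).2) hI)
    (hU.patternFree hα (by omega) ho hA).not_isC4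

theorem exists_weight_two_mul_sum_le (hU : HasHeavyClusters G U r α) (htwin : TwinFree G U)
    (hα : 2 ≤ α) (hr : 8 ≤ r) (ho : o ∈ U) :
    ∃ c : V → ℕ, (∀ v ∈ closedNbrsIn G U o, 1 ≤ c v) ∧
      (∃ H ⊆ U, #H ≤ 2 * #(closedNbrsIn G U o) ∧ ∀ v ∈ U, v ∉ H → c v = 0) ∧
      ∀ S, P3Free G S → 2 * ∑ v ∈ S, c v ≤ ∑ v ∈ U, c v + 1 := by
  classical
  set F := closedNbrsIn G U o
  have hFU : F ⊆ U := closedNbrsIn_subset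
  have hoF : o ∈ F := self_mem_closedNbrsIn ho
  obtain ⟨R, hR⟩ := exists_isTwinTransversal G F
  obtain ⟨p, hp, hpo⟩ := hR.exists_closedNbrsIn_eq o hoF
  have hadj : ∀ v ∈ R.erase p, G.Adj p v := by
    intro v hv
    obtain ⟨hvp, hv⟩ := mem_erase.1 hv
    refine adj_of_mem_closedNbrsIn (F := F) ?_ hvp
    rw [hpo]
    exact mem_closedNbrsIn.2 ⟨hR.subset hv, (mem_closedNbrsIn.1 (hR.subset hv)).2⟩
  have hpattern : PatternFree G (R.erase p) := hU.patternFree hα hr (hFU (hR.subset hp))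
    fun v hv => ⟨hFU (hR.subset (mem_of_mem_erase hv)), hadj v hv⟩
  obtain ⟨b, hb, hhalf⟩ := hR.twinFree.exists_weight_two_mul_sum_le hp hadj hpattern
  exact hR.exists_weight_two_mul_sum_le htwin hFU hb hhalf

end HasHeavyClusters

theorem LocallyFeasible.exists_weight_sum_le (hx : LocallyFeasible G r x)
    (hU : ∀ v ∈ U, α * x v < 1) (htwin : TwinFree G U) (hk : 1 ≤ (α - 2) * k)
    (hr : 2 * (k ^ 3 + 4) ≤ r) (ho : o ∈ U) :
    ∃ c : V → ℕ, (∀ v ∈ closedNbrsIn G U o, 1 ≤ c v) ∧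
      ∑ v ∈ U, (c v : ℝ) ≤ 2 * ∑ v ∈ U, c v * x v + 1 := by
  have hheavy := hx.hasHeavyClusters hU
  have hcard := hheavy.card_closedNbrsIn_le htwin hk hr ho
  obtain ⟨c, hc, ⟨H, hHU, hH, hcH⟩, hhalf⟩ :=
    hheavy.exists_weight_two_mul_sum_le htwin (two_le_of_one_le_sub_two_mul hk) (by omega) ho
  refine ⟨c, hc, ?_⟩
  have hfeasible := hx.sum_mul_one_sub_le (c := fun v => (c v : ℝ))
    (L := (∑ v ∈ U, (c v : ℝ) + 1) / 2) hHU (by omega)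
    (fun v hv hvH => by rw [hcH v hv hvH, Nat.cast_zero]) fun S _ hS => by
      rw [le_div_iff₀' two_pos]
      exact_mod_cast hhalf S hS
  simp only [mul_sub, mul_one, sum_sub_distrib] at hfeasible
  linarith

end LocalRatioWeights

section Rounding

open Finset

variable {V : Type*} {G : SimpleGraph V} {S U : Finset V} {o u v : V} {r k : ℕ} {α : ℝ}
  {x c : V → ℝ}

theorem LocallyFeasible.nonneg (hx : LocallyFeasible G r x) (hr : 1 ≤ r) (v : V) : 0 ≤ x v := by
  have hle := hx {v} (by simpa using hr) 1 1 fun S hS _ => by simpa using card_le_card hS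
  simpa using hle

theorem P3Free.insert_of_forall_not_adj [DecidableEq V] (hS : P3Free G S)
    (ho : ∀ z ∈ S, ¬ G.Adj o z) : P3Free G (insert o S) := by
  have hne : ∀ z ∈ insert o S, ∀ z' ∈ insert o S, G.Adj z z' → z ∈ S ∧ z' ∈ S := by
    grind [SimpleGraph.adj_comm, SimpleGraph.irrefl]
  intro a ha b hb d hd hab hbd
  exact hS a (hne a ha b hb hab).1 b (hne a ha b hb hab).2 d (hne b hb d hd hbd).2 hab hbd

theorem P3Free.insert_of_twin [DecidableEq V] (hS : P3Free G S) (hu : u ∈ S) (huv : G.Adj u v)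
    (htwin : ∀ z ∈ S, z ≠ u → z ≠ v → (G.Adj z u ↔ G.Adj z v)) : P3Free G (insert v S) := by
  have hadj : ∀ z ∈ S, z ≠ v → (G.Adj z v ↔ z = u ∨ G.Adj z u) := fun z hz hzv => by
    obtain rfl | hzu := eq_or_ne z u
    · simp [huv]
    · simp [hzu, htwin z hz hzu hzv]
  intro a ha b hb d hd hab hbd had
  by_cases hav : a = v <;> by_cases hbv : b = v <;> by_cases hdv : d = v
  all_goals grind [P3Free, SimpleGraph.adj_comm]

theorem P3Free.exists_superset_mem_closedNbrsIn (hS : P3Free G S) (hSU : S ⊆ U) (ho : o ∈ U) :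
    ∃ T ⊆ U, S ⊆ T ∧ P3Free G T ∧ ∃ z ∈ T, z ∈ closedNbrsIn G U o := by
  classical
  by_cases hmeet : ∃ z ∈ S, z ∈ closedNbrsIn G U o
  · exact ⟨S, hSU, subset_rfl, hS, hmeet⟩
  · push Not at hmeet
    exact ⟨insert o S, insert_subset ho hSU, subset_insert o S,
      hS.insert_of_forall_not_adj fun z hz hoz =>
        hmeet z hz (mem_closedNbrsIn.2 ⟨hSU hz, .inr hoz⟩),
      o, mem_insert_self o S, self_mem_closedNbrsIn ho⟩

/-- Some induced cluster graph `G[S]` with `S ⊆ U` can be kept such that deleting the rest of `U`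
costs at most `α` times the cost of the fractional solution `x` on `U`. -/
def IsRoundable (G : SimpleGraph V) (α : ℝ) (x : V → ℝ) (U : Finset V) (c : V → ℝ) : Prop :=
  ∃ S ⊆ U, P3Free G S ∧ ∑ v ∈ U, c v ≤ ∑ v ∈ S, c v + α * ∑ v ∈ U, c v * x v

namespace IsRoundable

theorem of_erase [DecidableEq V] (h : IsRoundable G α x (U.erase v) c) (hv : v ∈ U)
    (hcv : c v ≤ α * (c v * x v)) : IsRoundable G α x U c := by
  obtain ⟨S, hSU, hS, hle⟩ := h
  refine ⟨S, hSU.trans (erase_subset v U), hS, ?_⟩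
  rw [← add_sum_erase U _ hv, ← add_sum_erase U _ hv, mul_add]
  linarith

theorem of_twin [DecidableEq V]
    (h : IsRoundable G α x (U.erase v) (c + Pi.single u (c v))) (hα : 0 ≤ α) (hu : u ∈ U)
    (hv : v ∈ U) (hcv : 0 ≤ c v) (huv : G.Adj u v) (hxuv : x u ≤ x v)
    (htwin : ∀ z ∈ U, z ≠ u → z ≠ v → (G.Adj z u ↔ G.Adj z v)) : IsRoundable G α x U c := by
  obtain ⟨S, hSU, hS, hle⟩ := h
  have huU : u ∈ U.erase v := mem_erase.2 ⟨huv.ne, hu⟩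
  have hvS : v ∉ S := fun hvS => notMem_erase v U (hSU hvS)
  have hSU' : S ⊆ U := hSU.trans (erase_subset v U)
  have hcost : α * (c v * x u) ≤ α * (c v * x v) :=
    mul_le_mul_of_nonneg_left (mul_le_mul_of_nonneg_left hxuv hcv) hα
  simp only [Pi.add_apply, Pi.single_apply, add_mul, ite_mul, zero_mul, sum_add_distrib,
    sum_ite_eq', if_pos huU, mul_add] at hle
  by_cases huS : u ∈ S
  · refine ⟨insert v S, insert_subset hv hSU',
      hS.insert_of_twin huS huv fun z hz => htwin z (hSU' hz), ?_⟩
    rw [if_pos huS] at hle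
    rw [sum_insert hvS, ← add_sum_erase U _ hv, ← add_sum_erase U _ hv, mul_add]
    linarith
  · refine ⟨S, hSU', hS, ?_⟩
    rw [if_neg huS] at hle
    rw [← add_sum_erase U _ hv, ← add_sum_erase U _ hv, mul_add]
    linarith

theorem add_mul_of_sum_le {d : V → ℕ} {t : ℝ} (h : IsRoundable G α x U c)
    (hc : ∀ v ∈ U, 0 ≤ c v) (ht : 0 ≤ t) (ho : o ∈ U) (hd : ∀ v ∈ closedNbrsIn G U o, 1 ≤ d v)
    (hsum : ∑ v ∈ U, (d v : ℝ) ≤ α * ∑ v ∈ U, d v * x v + 1) :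
    IsRoundable G α x U (fun v => c v + t * d v) := by
  obtain ⟨S, hSU, hS, hle⟩ := h
  obtain ⟨T, hTU, hST, hT, z, hzT, hz⟩ := hS.exists_superset_mem_closedNbrsIn hSU ho
  refine ⟨T, hTU, hT, ?_⟩
  have hcST : ∑ v ∈ S, c v ≤ ∑ v ∈ T, c v :=
    sum_le_sum_of_subset_of_nonneg hST fun v hv _ => hc v (hTU hv)
  have hdT : 1 ≤ ∑ v ∈ T, (d v : ℝ) := by
    exact_mod_cast (hd z hz).trans (single_le_sum (f := d) (fun _ _ => Nat.zero_le _) hzT)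
  have hdU : t * ∑ v ∈ U, (d v : ℝ) ≤ t * (∑ v ∈ T, (d v : ℝ) + α * ∑ v ∈ U, d v * x v) :=
    mul_le_mul_of_nonneg_left (by linarith) ht
  simp only [sum_add_distrib, add_mul, mul_assoc, ← mul_sum]
  linarith

end IsRoundable

theorem exists_adj_twin_of_not_twinFree (hU : ¬ TwinFree G U) (x : V → ℝ) :
    ∃ u ∈ U, ∃ v ∈ U, G.Adj u v ∧ x u ≤ x v ∧
      ∀ z ∈ U, z ≠ u → z ≠ v → (G.Adj z u ↔ G.Adj z v) := by
  unfold TwinFree at hU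
  push Not at hU
  obtain ⟨u, hu, v, hv, huv, htwin⟩ := hU
  obtain hle | hle := le_total (x u) (x v)
  · exact ⟨u, hu, v, hv, huv, hle, htwin⟩
  · exact ⟨v, hv, u, hu, huv.symm, hle, fun z hz hzv hzu => (htwin z hz hzu hzv).symm⟩

theorem exists_sub_mul_nonneg_eq_zero (hc : ∀ v ∈ U, 0 ≤ c v) {d : V → ℕ} (ho : o ∈ U)
    (hdo : 1 ≤ d o) :
    ∃ t : ℝ, 0 ≤ t ∧ (∀ v ∈ U, 0 ≤ c v - t * d v) ∧ ∃ v ∈ U, c v - t * d v = 0 := by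
  obtain ⟨v, hv, hmin⟩ := exists_min_image {z ∈ U | 1 ≤ d z} (fun z => c z / d z)
    ⟨o, mem_filter.2 ⟨ho, hdo⟩⟩
  obtain ⟨hvU, hdv⟩ := mem_filter.1 hv
  refine ⟨c v / d v, div_nonneg (hc v hvU) (Nat.cast_nonneg _), fun z hz => ?_, v, hvU, ?_⟩
  · obtain hdz | hdz := Nat.eq_zero_or_pos (d z)
    · simpa [hdz] using hc z hz
    · rw [sub_nonneg, ← le_div_iff₀ (Nat.cast_pos.2 hdz)]
      exact hmin z (mem_filter.2 ⟨hz, hdz⟩)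
  · rw [div_mul_cancel₀ _ (Nat.cast_ne_zero.2 (Nat.one_le_iff_ne_zero.1 hdv)), sub_self]

theorem LocallyFeasible.isRoundable (hx : LocallyFeasible G r x) (hk : 1 ≤ (α - 2) * k)
    (hr : 2 * (k ^ 3 + 4) ≤ r) (hc : ∀ v ∈ U, 0 ≤ c v) : IsRoundable G α x U c := by
  classical
  have hα : 2 ≤ α := two_le_of_one_le_sub_two_mul hk
  have hx0 : ∀ v, 0 ≤ x v := hx.nonneg (by omega)
  induction U using Finset.strongInduction generalizing c with
  | H U ih =>
  obtain rfl | ⟨o, ho⟩ := U.eq_empty_or_nonempty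
  · exact ⟨∅, subset_rfl, by simp [P3Free], by simp⟩
  by_cases hlarge : ∃ v ∈ U, 1 ≤ α * x v
  · obtain ⟨v, hv, hxv⟩ := hlarge
    refine (ih _ (erase_ssubset hv) fun z hz => hc z (mem_of_mem_erase hz)).of_erase hv ?_
    rw [mul_left_comm]
    exact le_mul_of_one_le_right (hc v hv) hxv
  push Not at hlarge
  by_cases htwin : TwinFree G U
  · obtain ⟨d, hd, hsum⟩ := hx.exists_weight_sum_le hlarge htwin hk hr ho
    obtain ⟨t, ht, hct, v, hv, hvt⟩ :=
      exists_sub_mul_nonneg_eq_zero hc ho (hd o (self_mem_closedNbrsIn ho))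
    have hrest : IsRoundable G α x U (fun z => c z - t * d z) :=
      (ih _ (erase_ssubset hv) fun z hz => hct z (mem_of_mem_erase hz)).of_erase hv (by simp [hvt])
    have hdx : 0 ≤ ∑ z ∈ U, d z * x z :=
      sum_nonneg fun z _ => mul_nonneg (Nat.cast_nonneg _) (hx0 z)
    have hsum' : ∑ z ∈ U, (d z : ℝ) ≤ α * ∑ z ∈ U, d z * x z + 1 :=
      hsum.trans (by gcongr)
    simpa using hrest.add_mul_of_sum_le hct ht ho hd hsum'
  · obtain ⟨u, hu, v, hv, huv, hxuv, htw⟩ := exists_adj_twin_of_not_twinFree htwin x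
    have hmove : 0 ≤ (Pi.single u (c v) : V → ℝ) := Pi.single_nonneg.2 (hc v hv)
    have herase := ih _ (erase_ssubset hv) fun z hz =>
      add_nonneg (hc z (mem_of_mem_erase hz)) (hmove z)
    exact herase.of_twin (zero_le_two.trans hα) hu hv (hc v hv) huv hxuv htw

theorem clusterOPT_le_setCost [Fintype V] {X : Finset V} (hX : IsHittingSet G X)
    (hc : ∀ v, 0 ≤ c v) : clusterOPT G c ≤ setCost c X := by
  refine csInf_le ⟨0, ?_⟩ ⟨X, hX, rfl⟩
  rintro _ ⟨Y, -, rfl⟩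
  exact sum_nonneg fun v _ => hc v

theorem clusterOPT_le_mul_sum [Fintype V] (hk : 1 ≤ (α - 2) * k) (hr : 2 * (k ^ 3 + 4) ≤ r)
    (hc : ∀ v, 0 ≤ c v) (hx : x ∈ clusterSA r G) : clusterOPT G c ≤ α * ∑ v, c v * x v := by
  classical
  obtain ⟨S, -, hS, hle⟩ :=
    (locallyFeasible_of_mem_clusterSA hx).isRoundable hk hr fun v (_ : v ∈ univ) => hc v
  have hX : IsHittingSet G (univ \ S) :=
    isHittingSet_iff.2 (by rwa [Finset.sdiff_sdiff_eq_self (subset_univ S)])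
  refine (clusterOPT_le_setCost hX hc).trans ?_
  have := sum_sdiff (subset_univ S) (f := c)
  rw [setCost]
  linarith

theorem clusterOPT_le_mul_clusterSAValue [Fintype V] (hk : 1 ≤ (α - 2) * k)
    (hr : 2 * (k ^ 3 + 4) ≤ r) (hc : ∀ v, 0 ≤ c v) :
    clusterOPT G c ≤ α * clusterSAValue r G c := by
  have hα : 0 < α := two_pos.trans_le (two_le_of_one_le_sub_two_mul hk)
  rw [← div_le_iff₀' hα]
  obtain ⟨x, hx⟩ := clusterSA_nonempty G r
  refine le_csInf ⟨_, x, hx, rfl⟩ ?_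
  rintro _ ⟨y, hy, rfl⟩
  rw [div_le_iff₀' hα]
  exact clusterOPT_le_mul_sum hk hr hc hy

end Rounding

theorem mainTheorem3 :
    ∃ p : Polynomial ℝ, ∀ ε : ℝ, 0 < ε → ∃ r : ℕ, (r : ℝ) ≤ p.eval (1 / ε) ∧
      ∀ (V : Type*) [Fintype V] (G : SimpleGraph V),
        (∀ X : Finset V, IsHittingSet G X → (X : Set V).indicator 1 ∈ clusterSA r G) ∧
        ∀ c : V → ℝ, (∀ v, 0 ≤ c v) →
          clusterOPT G c ≤ (2 + ε) * clusterSAValue r G c := by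
  refine ⟨2 * ((Polynomial.X + 1) ^ 3 + 4), fun ε hε => ?_⟩
  set k := ⌈1 / ε⌉₊
  refine ⟨2 * (k ^ 3 + 4), ?_, fun V _ G => ⟨fun X => indicator_mem_clusterSA _, fun c hc => ?_⟩⟩
  · have hk : (k : ℝ) ≤ 1 / ε + 1 := (Nat.ceil_lt_add_one (by positivity)).le
    simp only [Polynomial.eval_add, Polynomial.eval_mul, Polynomial.eval_pow, Polynomial.eval_X,
      Polynomial.eval_one, Polynomial.eval_ofNat]
    push_cast
    gcongr
  · have hk : 1 ≤ (2 + ε - 2) * k := by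
      rw [add_sub_cancel_left, ← div_le_iff₀' hε]
      exact Nat.le_ceil (1 / ε)
    exact clusterOPT_le_mul_clusterSAValue hk le_rfl hc
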